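/- Consider a finite Markov decision process with $S$ states, $A$ actions, transition laws $P(\cdot\mid s,a)$, reward laws $R(\cdot\mid s,a)$ satisfying $|r|\le r_{\max}$ almost surely for all $(s,a)$, and discount factor $\gamma\in[0,1)$. Let $\pi$ be a stationary (deterministic or randomized) policy with value matrix $$Q^\pi(s,a)=\mathbb E\Big[\sum_{t=0}^\infty\gamma^t r_t\,\Big|\,s_0=s,\ a_0=a\Big]\in\mathbb R^{S\times A},$$ where $a_t\sim\pi(s_t)$ for $t\ge1$. Assume $Q^\pi\ne0$, let $d_\pi=\operatorname{rank}(Q^\pi)$, and let $\sigma_{d_\pi}(Q^\pi)$ be its smallest non-zero singular value. Let $\delta\in(0,1)$, let $T\ge1$ be an integer (the sampling budget), and set $$\tau=\Big\lceil\tfrac1{1-\gamma}\log\tfrac{T}{1-\gamma}\Big\rceil,\qquad N=\Big\lfloor\frac{T}{\tau+1}\Big\rfloor,\qquad L=\log\Big(\frac{(S+A)T}{(1-\gamma)\delta}\Big),$$ $$\beta=\sqrt{\frac{r_{\max}^2SA(S+A)}{(1-\gamma)^3T}\,L^4}+\frac{r_{\max}\sqrt{SA}}{T}.$$ Sample $N$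 independent trajectories $(s_{k,t},a_{k,t},r_{k,t})_{0\le t\le\tau}$, $k=1,\dots,N$, with $(s_{k,0},a_{k,0})$ uniform on the $SA$ state-action pairs and $\pi$ followed afterwards. Let $$\widetilde Q^\pi_\tau(s,a)=\frac{SA}{N}\sum_{k=1}^N\Big(\sum_{t=0}^\tau\gamma^t r_{k,t}\Big)\mathbf 1\{(s_{k,0},a_{k,0})=(s,a)\},$$ let $\hat\sigma_1\ge\hat\sigma_2\ge\dots\ge\hat\sigma_{S\wedge A}$ be the singular values of $\widetilde Q^\pi_\tau$, and let $\hat d=\sum_{i=1}^{S\wedge A}\mathbf 1\{\hat\sigma_i\ge\beta\}$. There is a universal constant $C>0$ (independent of $S$, $A$, the process, $\pi$, $r_{\max}$, $\gamma$, $\delta$ and $T$) such that, whenever $$T\ \ge\ C\,\frac{r_{\max}^2\,SA(S+A)}{(1-\gamma)^3\,\sigma_{d_\pi}^2(Q^\pi)}\,L^4,$$ one has $\hat d=d_\pi$ with probability at least $1-\delta$. -/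

import Mathlib

open MeasureTheory ProbabilityTheory
open scoped ENNReal

namespace LowRankRL

/-- A finite Markov decision process with `S` states and `A` actions: `P s a` is the law of the next
state and `R s a` the law of the (random, real-valued) reward, given the current state `s` and the
current action `a`. -/
structure MDP (S A : ℕ) where
  P : Fin S → Fin A → PMF (Fin S)
  R : Fin S → Fin A → ProbabilityMeasure ℝ

/-- All rewards are almost surely bounded by `rmax` in absolute value. -/
def MDP.RewardBoundedBy {S A : ℕ} (M : MDP S A) (rmax : ℝ) : Prop :=
  ∀ s a, ∀ᵐ x ∂(M.R s a : Measure ℝ), |x| ≤ rmax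

/-- A stationary policy: `π s` is the law of the action played in state `s`. A deterministic policy
`f : Fin S → Fin A` is the special case `fun s => PMF.pure (f s)`. -/
abbrev Policy (S A : ℕ) := Fin S → PMF (Fin A)

/-- One time step of an interaction: a state, an action, a reward. -/
abbrev Transition (S A : ℕ) := Fin S × Fin A × ℝ

section

variable {S A : ℕ}

/-- The law of `(s, a, r)` when the state `s` and the action `a` are given and `r` is drawn from the
reward law of `(s, a)`. -/
noncomputable def MDP.emit (M : MDP S A) (sa : Fin S × Fin A) : Measure (Transition S A) :=
  (M.R sa.1 sa.2 : Measure ℝ).map fun r => (sa.1, sa.2, r)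

instance (M : MDP S A) (sa : Fin S × Fin A) : IsProbabilityMeasure (M.emit sa) :=
  Measure.isProbabilityMeasure_map (by fun_prop)

/-- The law of the next time step `(s', a', r')` given the current state and action:
`s' ∼ P s a`, `a' ∼ π s'`, and `r'` has the reward law of `(s', a')`. -/
noncomputable def MDP.next (M : MDP S A) (π : Policy S A) (sa : Fin S × Fin A) :
    Measure (Transition S A) :=
  ∑ s' : Fin S, ∑ a' : Fin A, (M.P sa.1 sa.2 s' * π s' a') • M.emit (s', a')

instance (M : MDP S A) (π : Policy S A) (sa : Fin S × Fin A) :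
    IsProbabilityMeasure (M.next π sa) := by
  constructor
  have h : ∀ {n : ℕ} (p : PMF (Fin n)), ∑ i, p i = 1 := fun p => by
    rw [← tsum_fintype (L := .unconditional _), p.tsum_coe]
  simp [MDP.next, ← Finset.mul_sum, h]

/-- The transition kernel at time `n`: the past enters through the current state and action only. -/
noncomputable def MDP.stepKernel (M : MDP S A) (π : Policy S A) (n : ℕ) :
    Kernel (Π _ : Finset.Iic n, Transition S A) (Transition S A) :=
  (Kernel.ofFunOfCountable (M.next π)).comap
    (fun h => ((h ⟨n, Finset.mem_Iic.2 le_rfl⟩).1, (h ⟨n, Finset.mem_Iic.2 le_rfl⟩).2.1))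
    (by fun_prop)

instance (M : MDP S A) (π : Policy S A) (n : ℕ) : IsMarkovKernel (M.stepKernel π n) := by
  refine ⟨fun h => ?_⟩
  rw [MDP.stepKernel, Kernel.comap_apply]
  exact inferInstanceAs (IsProbabilityMeasure (M.next π _))

/-- The law of the infinite trajectory `(s_t, a_t, r_t)_{t ≥ 0}` that starts in the state `s` with the
action `a` and then follows the policy `π`. -/
noncomputable def MDP.trajLaw (M : MDP S A) (π : Policy S A) (s : Fin S) (a : Fin A) :
    Measure (ℕ → Transition S A) :=
  Kernel.trajMeasure (X := fun _ => Transition S A) (M.emit (s, a)) (M.stepKernel π)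

instance (M : MDP S A) (π : Policy S A) (s : Fin S) (a : Fin A) :
    IsProbabilityMeasure (M.trajLaw π s a) := by
  unfold MDP.trajLaw; infer_instance

/-- The value matrix `Q^π(s, a) = 𝔼[∑_{t ≥ 0} γ^t r_t | s_0 = s, a_0 = a]`. -/
noncomputable def MDP.Q (M : MDP S A) (π : Policy S A) (γ : ℝ) : Matrix (Fin S) (Fin A) ℝ :=
  Matrix.of fun s a => ∫ ω, ∑' t : ℕ, γ ^ t * (ω t).2.2 ∂(M.trajLaw π s a)

/-- The law of a trajectory whose initial state-action pair is uniform on the `S * A` pairs. -/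
noncomputable def MDP.unifLaw (M : MDP S A) (π : Policy S A) : Measure (ℕ → Transition S A) :=
  ((S * A : ℕ) : ℝ≥0∞)⁻¹ • ∑ s : Fin S, ∑ a : Fin A, M.trajLaw π s a

/-- The law of `N` independent trajectories, each with uniform initial state-action pair. -/
noncomputable def MDP.dataLaw (M : MDP S A) (π : Policy S A) (N : ℕ) :
    Measure (Fin N → ℕ → Transition S A) :=
  Measure.pi fun _ => M.unifLaw π

/-- The empirical truncated value matrix: only the times `0, …, τ` of each of the `N` sampled
trajectories `ω k` are used. -/
noncomputable def empiricalQ (γ : ℝ) (τ : ℕ) {N : ℕ} (ω : Fin N → ℕ → Transition S A) :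
    Matrix (Fin S) (Fin A) ℝ :=
  Matrix.of fun s a => ((S : ℝ) * A / N) * ∑ k : Fin N,
    if (ω k 0).1 = s ∧ (ω k 0).2.1 = a then
      ∑ t ∈ Finset.range (τ + 1), γ ^ t * (ω k t).2.2
    else 0

/-- The `i`-th largest singular value of a matrix, counted from `i = 1`. -/
noncomputable def singularValue (B : Matrix (Fin S) (Fin A) ℝ) (i : ℕ) : ℝ :=
  (Matrix.toEuclideanLin B).singularValues (i - 1)

/-- The number of indices `1 ≤ i ≤ min S A` with `β ≤ σ_i(B)`. -/
noncomputable def thresholdRank (B : Matrix (Fin S) (Fin A) ℝ) (β : ℝ) : ℕ :=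
  {i ∈ Finset.Icc 1 (min S A) | β ≤ singularValue B i}.card

end

/-- The truncation level `τ = (1 / (1 - γ)) log (T / (1 - γ))`, rounded up. -/
noncomputable def horizon (γ : ℝ) (T : ℕ) : ℕ := ⌈1 / (1 - γ) * Real.log (T / (1 - γ))⌉₊

/-- The number of trajectories with `τ + 1` steps that a budget of `T` steps affords. -/
noncomputable def numTraj (γ : ℝ) (T : ℕ) : ℕ := T / (horizon γ T + 1)

/-- The logarithmic factor `log ((S + A) T / ((1 - γ) δ))`. -/
noncomputable def logFactor (S A : ℕ) (γ δ : ℝ) (T : ℕ) : ℝ :=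
  Real.log (((S : ℝ) + A) * T / ((1 - γ) * δ))

/-- The threshold `β`. -/
noncomputable def threshold (S A : ℕ) (rmax γ δ : ℝ) (T : ℕ) : ℝ :=
  √(rmax ^ 2 * S * A * (S + A) / ((1 - γ) ^ 3 * T) * logFactor S A γ δ T ^ 4)
    + rmax * √((S : ℝ) * A) / T

end LowRankRL

/-! The estimator is a rescaled sum of independent, identically distributed matrices with at most
one non-zero entry each, and its expectation is the truncated value matrix. Truncation changes each
entry by at most rmax / T, hence the operator norm by at most rmax √(SA) / T, the second summand of
β. If the sampling error has operator norm below the first summand R, the total error is below β. As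
2β ≤ σ_d for the true rank d, Weyl-type inequalities keep the d-th empirical singular value at least
β and push the next one below β, so the count is exactly d.

The sampling error is controlled by a matrix Bernstein inequality built from first principles. The
Hermitian dilation makes the summands symmetric. `trace_exp_add_le` (Golden-Thompson) peels the
samples one at a time off the Laplace transform tr exp, and exp X ≤ 1 + X + X² makes each sample
cost a factor 1 + v, where v bounds the second moment. This gives the tail (S + A) exp(N v - t).
Scaling the error by θ = 2l / R, with l the logarithmic factor, turns deviation R into t = 2l. Since
N v ≤ l, the failure probability is at most (S + A) exp(-l) ≤ δ.

The numerical constants are absorbed by a large l: all singular values of Q are at most 2 rmax √(SA)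
/ (1 - γ), so the sample size condition with C = 32 e^100 forces T ≥ e^100, hence l ≥ 100. -/

namespace LowRankRL

/-! ### Golden-Thompson inequality via Lie-Trotter -/

section GoldenThompson

open Matrix NormedSpace Filter Topology

/-- The Cauchy-Schwarz inequality for the trace inner product, in arithmetic-geometric form. -/
theorem two_mul_trace_mul_transpose_le {n : Type*} [Fintype n] (M K : Matrix n n ℝ) :
    2 * (M * Kᵀ).trace ≤ (M * Mᵀ).trace + (K * Kᵀ).trace := by
  have h : 0 ≤ ((M - K) * (M - K)ᵀ).trace := by
    simp only [Matrix.trace, Matrix.diag_apply, Matrix.mul_apply, Matrix.transpose_apply]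
    exact Finset.sum_nonneg fun i _ => Finset.sum_nonneg fun j _ => mul_self_nonneg _
  have h2 : (K * Mᵀ).trace = (M * Kᵀ).trace := by
    rw [← Matrix.trace_transpose, Matrix.transpose_mul, Matrix.transpose_transpose]
  rw [Matrix.transpose_sub, sub_mul, mul_sub, mul_sub] at h
  simp only [Matrix.trace_sub] at h
  linarith

variable {n : Type*} [Fintype n] [DecidableEq n]

theorem trace_mul_pow_comm (M K : Matrix n n ℝ) (m : ℕ) :
    ((M * K) ^ m).trace = ((K * M) ^ m).trace := by
  cases m with
  | zero => simp
  | succ m =>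
    rw [pow_succ, ← mul_assoc, Matrix.trace_mul_comm, ← mul_assoc]
    congr 1
    have : K * (M * K) ^ m = (K * M) ^ m * K := by
      induction m with
      | zero => simp
      | succ m ih => rw [pow_succ, pow_succ, ← mul_assoc, ih]; simp only [mul_assoc]
    rw [this, mul_assoc, pow_succ]

/-- Trace inequalities of Weyl and Lieb-Thirring type, for exponents that are powers of two. -/
theorem trace_pow_two_pow_le (j : ℕ) :
    (∀ M : Matrix n n ℝ, (M ^ (2 * 2 ^ j)).trace ≤ ((M * Mᵀ) ^ 2 ^ j).trace) ∧
    (∀ P Q : Matrix n n ℝ, P.IsSymm → Q.IsSymm →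
      ((P * Q) ^ 2 ^ j).trace ≤ (P ^ 2 ^ j * Q ^ 2 ^ j).trace) := by
  induction j with
  | zero =>
    refine ⟨fun M => ?_, fun P Q _ _ => by simp⟩
    have := two_mul_trace_mul_transpose_le M Mᵀ
    rw [Matrix.transpose_transpose, Matrix.trace_mul_comm Mᵀ M] at this
    simp only [pow_zero, mul_one, pow_one, pow_two]
    linarith
  | succ j ih =>
    obtain ⟨hK, hL⟩ := ih
    constructor
    · intro M
      set P := Mᵀ * M with hP
      set Q := M * Mᵀ with hQ
      have hPs : P.IsSymm := by simp [hP, Matrix.IsSymm]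
      have hQs : Q.IsSymm := by simp [hQ, Matrix.IsSymm]
      -- The first inequality for `M ^ 2`, after cyclic rotation, produces a power of `P * Q`. The
      -- second inequality and Cauchy-Schwarz then separate `P` from `Q`, whose powers have equal
      -- traces.
      have h1 : (M ^ (2 * 2 ^ (j + 1))).trace ≤ ((P * Q) ^ 2 ^ j).trace := by
        have := hK (M ^ 2)
        rw [← pow_mul, show 2 * (2 * 2 ^ j) = 2 * 2 ^ (j + 1) by ring] at this
        refine this.trans_eq ?_
        rw [show M ^ 2 * (M ^ 2)ᵀ = M * (M * (Mᵀ * Mᵀ)) by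
          simp only [pow_two, Matrix.transpose_mul, mul_assoc], trace_mul_pow_comm]
        rw [trace_mul_pow_comm P Q]
        simp only [hP, hQ, mul_assoc]
      have h2 := hL P Q hPs hQs
      have h3 := two_mul_trace_mul_transpose_le (P ^ 2 ^ j) (Q ^ 2 ^ j)
      rw [Matrix.transpose_pow, Matrix.transpose_pow, hPs, hQs, ← pow_add, ← pow_add,
        show 2 ^ j + 2 ^ j = 2 ^ (j + 1) by ring] at h3
      have h4 : (P ^ 2 ^ (j + 1)).trace = (Q ^ 2 ^ (j + 1)).trace := trace_mul_pow_comm _ _ _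
      linarith
    · intro P Q hP hQ
      -- The first inequality at level j, applied to `P * Q`, becomes after rotation a trace of
      -- powers of `P ^ 2 * Q ^ 2`, to which the second inequality at level j applies.
      have h1 := hK (P * Q)
      rw [show 2 * 2 ^ j = 2 ^ (j + 1) by ring] at h1
      refine h1.trans ?_
      rw [Matrix.transpose_mul, hP, hQ, show P * Q * (Q * P) = P * (Q * (Q * P)) by
        simp only [mul_assoc], trace_mul_pow_comm, show Q * (Q * P) * P = Q ^ 2 * P ^ 2 by
        simp only [pow_two, mul_assoc], trace_mul_pow_comm]
      refine (hL (P ^ 2) (Q ^ 2) (hP.pow 2) (hQ.pow 2)).trans_eq ?_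
      rw [← pow_mul, ← pow_mul, show 2 * 2 ^ j = 2 ^ (j + 1) by ring]

/-- Telescoping: replace the factors x by y one at a time; `1 ≤ c` makes the surplus powers of c
harmless. -/
theorem norm_pow_sub_pow_le {R : Type*} [NormedRing R] (x y : R) (c : ℝ)
    (hc : 1 ≤ c) (hx : ‖x‖ ≤ c) (hy : ‖y‖ ≤ c) (m : ℕ) :
    ‖x ^ m - y ^ m‖ ≤ m * c ^ m * ‖x - y‖ := by
  have hc0 : 0 ≤ c := zero_le_one.trans hc
  induction m with
  | zero => simp
  | succ m ih =>
    have hp : ∀ z : R, ‖z‖ ≤ c → ∀ w : R, ‖w * z ^ m‖ ≤ ‖w‖ * c ^ m := by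
      intro z hz w
      induction m with
      | zero => simp
      | succ m _ =>
        refine (norm_mul_le _ _).trans ?_
        gcongr
        exact (norm_pow_le' z m.succ_pos).trans (by gcongr)
    have e : x ^ (m + 1) - y ^ (m + 1) = (x ^ m - y ^ m) * x + (y ^ m) * (x - y) := by
      rw [pow_succ, pow_succ]; noncomm_ring
    -- The exponent 0 is separate because ‖1‖ ≤ 1 is not assumed in `R`.
    have hq : ‖y ^ m * (x - y)‖ ≤ c ^ m * ‖x - y‖ := by
      cases m with
      | zero => simp
      | succ m =>
        refine (norm_mul_le _ _).trans ?_
        gcongr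
        exact (norm_pow_le' y m.succ_pos).trans (by gcongr)
    have h1 : ‖(x ^ m - y ^ m) * x‖ ≤ m * c ^ m * ‖x - y‖ * c :=
      (norm_mul_le _ _).trans (by gcongr)
    have h2 : c ^ m * ‖x - y‖ ≤ c ^ (m + 1) * ‖x - y‖ := by
      gcongr
      exact m.le_succ
    calc _ ≤ ‖(x ^ m - y ^ m) * x‖ + ‖y ^ m * (x - y)‖ := by rw [e]; exact norm_add_le _ _
      _ ≤ m * c ^ m * ‖x - y‖ * c + c ^ (m + 1) * ‖x - y‖ := by linarith
      _ = _ := by push_cast; ring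

/-- The Lie-Trotter product formula. -/
theorem tendsto_exp_mul_exp_pow {R : Type*} [NormedRing R] [NormOneClass R] [NormedAlgebra ℝ R]
    [CompleteSpace R] (a b : R) :
    Tendsto (fun m : ℕ => (exp ((m : ℝ)⁻¹ • a) * exp ((m : ℝ)⁻¹ • b)) ^ m) atTop
      (𝓝 (exp (a + b))) := by
  let : NormedAlgebra ℚ R := NormedAlgebra.restrictScalars ℚ ℝ R
  set f : ℝ → R := fun t => exp (t • a) * exp (t • b) with hf
  set g : ℝ → R := fun t => exp (t • (a + b)) with hg
  -- Both curves start at 1 with velocity a + b, so f(1/m) - g(1/m) = o(1/m). Telescoping loses only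
  -- a factor m times a bounded constant.
  have hf' : HasDerivAt f (a + b) 0 := by
    refine ((hasDerivAt_exp_smul_const a (0 : ℝ)).mul
      (hasDerivAt_exp_smul_const b (0 : ℝ))).congr_deriv ?_
    simp
  have hg' : HasDerivAt g (a + b) 0 := by
    refine (hasDerivAt_exp_smul_const (a + b) (0 : ℝ)).congr_deriv ?_
    simp
  have hf0 : f 0 = 1 := by simp [hf]
  have hg0 : g 0 = 1 := by simp [hg]
  have hseq : Tendsto (fun m : ℕ => ((m : ℝ))⁻¹) atTop (𝓝[>] 0) :=
    tendsto_inv_atTop_nhdsGT_zero.comp tendsto_natCast_atTop_atTop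
  have hseq0 : Tendsto (fun m : ℕ => ((m : ℝ))⁻¹) atTop (𝓝 0) := hseq.mono_right nhdsWithin_le_nhds
  have hseq1 : Tendsto (fun m : ℕ => ((m : ℝ))⁻¹) atTop (𝓝[≠] 0) :=
    hseq.mono_right (nhdsWithin_mono _ fun x hx => ne_of_gt hx)
  have hnorm : ∀ h : ℝ → R, h 0 = 1 → HasDerivAt h (a + b) 0 →
      ∃ k : ℝ, ∀ᶠ m : ℕ in atTop, ‖h ((m : ℝ)⁻¹)‖ ≤ 1 + k * (m : ℝ)⁻¹ := by
    intro h h0 hd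
    obtain ⟨k, hk⟩ := hd.isBigO_sub.bound
    refine ⟨k, ?_⟩
    filter_upwards [hseq0.eventually hk] with m hm
    rw [h0, sub_zero, Real.norm_of_nonneg (by positivity)] at hm
    have : ‖h ((m : ℝ)⁻¹)‖ ≤ ‖(1 : R)‖ + ‖h ((m : ℝ)⁻¹) - 1‖ := by
      simpa using norm_add_le (1 : R) (h ((m : ℝ)⁻¹) - 1)
    rw [norm_one] at this
    linarith
  obtain ⟨k₁, hk₁⟩ := hnorm f hf0 hf'
  obtain ⟨k₂, hk₂⟩ := hnorm g hg0 hg'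
  set k := max (max k₁ k₂) 0 with hk
  have hslope : Tendsto (fun m : ℕ => Real.exp k *
      ‖((m : ℝ)⁻¹)⁻¹ • ((f - g) (0 + (m : ℝ)⁻¹) - (f - g) 0)‖) atTop (𝓝 0) := by
    have h1 := (hasDerivAt_iff_tendsto_slope_zero.1 (hf'.sub hg')).comp hseq1
    rw [sub_self] at h1
    simpa using (h1.norm.const_mul (Real.exp k))
  rw [tendsto_iff_norm_sub_tendsto_zero]
  refine squeeze_zero' (Eventually.of_forall fun _ => norm_nonneg _) ?_ hslope
  filter_upwards [hk₁, hk₂, eventually_gt_atTop 0] with m h1 h2 hm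
  have hm0 : (0 : ℝ) < m := by exact_mod_cast hm
  have hgm : exp (a + b) = g ((m : ℝ)⁻¹) ^ m := by
    rw [hg]
    simp only
    rw [← NormedSpace.exp_nsmul, ← Nat.cast_smul_eq_nsmul ℝ, smul_smul, mul_inv_cancel₀ hm0.ne', one_smul]
  rw [hgm]
  have hc1 : k₁ * (m : ℝ)⁻¹ ≤ k * (m : ℝ)⁻¹ := by gcongr; simp [hk]
  have hc2 : k₂ * (m : ℝ)⁻¹ ≤ k * (m : ℝ)⁻¹ := by gcongr; simp [hk]
  have hk0 : 0 ≤ k := le_max_right _ _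
  have hexp : (1 + k * (m : ℝ)⁻¹) ^ m ≤ Real.exp k := by
    calc (1 + k * (m : ℝ)⁻¹) ^ m ≤ Real.exp (k * (m : ℝ)⁻¹) ^ m := by
          gcongr
          linarith [Real.add_one_le_exp (k * (m : ℝ)⁻¹)]
      _ = Real.exp k := by
          rw [← Real.exp_nat_mul]
          congr 1
          field_simp
  refine (norm_pow_sub_pow_le (f ((m : ℝ)⁻¹)) (g ((m : ℝ)⁻¹)) (1 + k * (m : ℝ)⁻¹)
    (by linarith [mul_nonneg hk0 (inv_nonneg.2 hm0.le)]) (by linarith) (by linarith) m).trans ?_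
  simp only [Pi.sub_apply, hf0, hg0, sub_self, sub_zero, zero_add, inv_inv, norm_smul,
    Real.norm_natCast]
  calc _ ≤ m * Real.exp k * ‖f ((m : ℝ)⁻¹) - g ((m : ℝ)⁻¹)‖ := by gcongr
    _ = _ := by ring

/-- The Golden-Thompson inequality for real symmetric matrices. -/
theorem trace_exp_add_le (a b : Matrix n n ℝ) (ha : a.IsSymm) (hb : b.IsSymm) :
    (exp (a + b)).trace ≤ (exp a * exp b).trace := by
  let : NormedRing (Matrix n n ℝ) := Matrix.linftyOpNormedRing
  let : NormedAlgebra ℝ (Matrix n n ℝ) := Matrix.linftyOpNormedAlgebra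
  cases isEmpty_or_nonempty n
  · simp [Matrix.trace]
  have : NormOneClass (Matrix n n ℝ) := Matrix.linfty_opNormOneClass
  -- The trace inequality is available only for powers of two, so the product formula is used along
  -- m = 2^j.
  have h1 := (tendsto_exp_mul_exp_pow a b).comp (tendsto_pow_atTop_atTop_of_one_lt one_lt_two)
  have h2 := (((continuous_id.matrix_trace).tendsto (exp (a + b)))).comp h1
  refine le_of_tendsto h2 (Eventually.of_forall fun j => ?_)
  have hs : ∀ c : Matrix n n ℝ, c.IsSymm →
      (exp ((((2 : ℕ) ^ j : ℕ) : ℝ)⁻¹ • c)).IsSymm := fun c hc => (hc.smul _).exp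
  have hp : ∀ c : Matrix n n ℝ, exp ((((2 : ℕ) ^ j : ℕ) : ℝ)⁻¹ • c) ^ 2 ^ j = exp c := fun c => by
    rw [← Matrix.exp_nsmul, ← Nat.cast_smul_eq_nsmul ℝ, smul_smul, mul_inv_cancel₀ (by positivity),
      one_smul]
  have := (trace_pow_two_pow_le j).2 _ _ (hs a ha) (hs b hb)
  rwa [hp, hp] at this

end GoldenThompson

/-! ### Spectral estimates for the exponential of a symmetric matrix -/

section QuadraticForm

open Matrix NormedSpace

variable {n : Type*} [Fintype n] [DecidableEq n]

theorem exists_eq_mul_diagonal_mul_transpose {X : Matrix n n ℝ} (hX : X.IsSymm) :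
    ∃ (U : Matrix n n ℝ) (l : n → ℝ), Uᵀ * U = 1 ∧ U * Uᵀ = 1 ∧ X = U * diagonal l * Uᵀ := by
  have hH : X.IsHermitian := by rwa [Matrix.IsHermitian, Matrix.conjTranspose_eq_transpose_of_trivial]
  refine ⟨hH.eigenvectorUnitary, hH.eigenvalues, ?_, ?_, ?_⟩
  · simpa [star_eq_conjTranspose, conjTranspose_eq_transpose_of_trivial] using
      Unitary.coe_star_mul_self hH.eigenvectorUnitary
  · simpa [star_eq_conjTranspose, conjTranspose_eq_transpose_of_trivial] using
      Unitary.coe_mul_star_self hH.eigenvectorUnitary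
  · have := hH.spectral_theorem
    rw [Unitary.conjStarAlgAut_apply] at this
    simpa [star_eq_conjTranspose, conjTranspose_eq_transpose_of_trivial, Function.comp_def]
      using this

theorem exp_mul_diagonal_mul_transpose {U : Matrix n n ℝ} (h1 : Uᵀ * U = 1) (h2 : U * Uᵀ = 1)
    (l : n → ℝ) :
    exp (U * diagonal l * Uᵀ) = U * diagonal (fun i => Real.exp (l i)) * Uᵀ := by
  have hU : IsUnit U := ⟨⟨U, Uᵀ, h2, h1⟩, rfl⟩
  have hinv : U⁻¹ = Uᵀ := Matrix.inv_eq_right_inv h2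
  rw [← hinv, Matrix.exp_conj U _ hU, Matrix.exp_diagonal]
  congr 3
  ext i
  rw [Pi.coe_exp, Real.exp_eq_exp_ℝ]

theorem dotProduct_mul_diagonal_mul_transpose (U : Matrix n n ℝ) (l u : n → ℝ) :
    u ⬝ᵥ ((U * diagonal l * Uᵀ) *ᵥ u) = ∑ i, l i * (Uᵀ *ᵥ u) i ^ 2 := by
  rw [← mulVec_mulVec, ← mulVec_mulVec, dotProduct_mulVec, ← mulVec_transpose, dotProduct]
  refine Finset.sum_congr rfl fun i _ => ?_
  rw [mulVec_diagonal]
  ring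

theorem dotProduct_self_eq_sum_transpose_mulVec {U : Matrix n n ℝ} (h2 : U * Uᵀ = 1) (u : n → ℝ) :
    u ⬝ᵥ u = ∑ i, (Uᵀ *ᵥ u) i ^ 2 := by
  have := dotProduct_mul_diagonal_mul_transpose U 1 u
  simpa [Pi.one_def, h2] using this

/-- The quadratic form of `exp X` for a symmetric contraction `X`. -/
theorem dotProduct_exp_mulVec_le {X : Matrix n n ℝ} (hX : X.IsSymm)
    (h : ∀ u, (X *ᵥ u) ⬝ᵥ (X *ᵥ u) ≤ u ⬝ᵥ u) (u : n → ℝ) :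
    u ⬝ᵥ (exp X *ᵥ u) ≤ u ⬝ᵥ u + u ⬝ᵥ (X *ᵥ u) + (X *ᵥ u) ⬝ᵥ (X *ᵥ u) := by
  obtain ⟨U, l, h1, h2, rfl⟩ := exists_eq_mul_diagonal_mul_transpose hX
  have hsq : ∀ u, ((U * diagonal l * Uᵀ) *ᵥ u) ⬝ᵥ ((U * diagonal l * Uᵀ) *ᵥ u)
      = ∑ i, l i ^ 2 * (Uᵀ *ᵥ u) i ^ 2 := by
    intro u
    rw [dotProduct_self_eq_sum_transpose_mulVec h2]
    refine Finset.sum_congr rfl fun i _ => ?_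
    rw [mulVec_mulVec, ← mul_assoc, ← mul_assoc, h1, one_mul, ← mulVec_mulVec, mulVec_diagonal]
    ring
  -- Testing the contraction on the i-th eigenvector bounds the i-th eigenvalue.
  have hl : ∀ i, |l i| ≤ 1 := by
    intro i
    have := h (U *ᵥ Pi.single i 1)
    rw [hsq, dotProduct_self_eq_sum_transpose_mulVec h2, mulVec_mulVec, h1, one_mulVec,
      Finset.sum_eq_single i, Finset.sum_eq_single i] at this
    · simpa using this
    all_goals simp +contextual
  rw [exp_mul_diagonal_mul_transpose h1 h2, hsq, dotProduct_mul_diagonal_mul_transpose,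
    dotProduct_mul_diagonal_mul_transpose, dotProduct_self_eq_sum_transpose_mulVec h2,
    ← Finset.sum_add_distrib, ← Finset.sum_add_distrib]
  refine Finset.sum_le_sum fun i _ => ?_
  -- On [-1, 1] the scalar inequality e^x ≤ 1 + x + x² holds; it is weighted by the squared
  -- coordinates and summed.
  have h3 := abs_le.1 (Real.abs_exp_sub_one_sub_id_le (hl i))
  nlinarith [sq_nonneg ((Uᵀ *ᵥ u) i)]

theorem trace_exp_pos [Nonempty n] {X : Matrix n n ℝ} (hX : X.IsSymm) : 0 < (exp X).trace := by
  obtain ⟨U, l, h1, h2, rfl⟩ := exists_eq_mul_diagonal_mul_transpose hX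
  rw [exp_mul_diagonal_mul_transpose h1 h2, trace_mul_comm, ← mul_assoc, h1, one_mul,
    trace_diagonal]
  exact Finset.sum_pos (fun i _ => Real.exp_pos _) Finset.univ_nonempty

/-- In an eigenbasis of X the trace is a sum of diagonal entries of E with positive weights e^{l_i},
and each such entry is the quadratic form of E at a unit vector. -/
theorem trace_exp_mul_le {X E : Matrix n n ℝ} (hX : X.IsSymm) {c : ℝ}
    (hE : ∀ u, u ⬝ᵥ (E *ᵥ u) ≤ c * (u ⬝ᵥ u)) :
    (exp X * E).trace ≤ c * (exp X).trace := by
  obtain ⟨U, l, h1, h2, rfl⟩ := exists_eq_mul_diagonal_mul_transpose hX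
  rw [exp_mul_diagonal_mul_transpose h1 h2]
  have e1 : (U * diagonal (fun i => Real.exp (l i)) * Uᵀ * E).trace
      = ∑ i, Real.exp (l i) * (Uᵀ * E * U) i i := by
    rw [mul_assoc, mul_assoc, trace_mul_comm, mul_assoc, Matrix.trace]
    simp [Matrix.diag_apply, diagonal_mul]
  rw [e1, trace_mul_comm, ← mul_assoc, h1, one_mul, trace_diagonal, Finset.mul_sum]
  refine Finset.sum_le_sum fun i _ => ?_
  rw [mul_comm c]
  refine mul_le_mul_of_nonneg_left ?_ (Real.exp_pos _).le
  have h3 := hE (U *ᵥ Pi.single i 1)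
  rw [dotProduct_self_eq_sum_transpose_mulVec h2, mulVec_mulVec, mulVec_mulVec, h1, one_mulVec,
    Finset.sum_eq_single i (by simp +contextual) (by simp)] at h3
  have e2 : (Uᵀ * E * U) i i = (U *ᵥ Pi.single i 1) ⬝ᵥ ((E * U) *ᵥ Pi.single i 1) := by
    rw [mulVec_single_one, mulVec_single_one, mul_assoc, mul_apply_eq_vecMul, vecMul]
    rfl
  rw [e2]
  simpa using h3

/-- The trace dominates each e^{l_i}, so every eigenvalue is below t. This converts a trace bound
into an operator bound. -/
theorem dotProduct_mulVec_lt_of_trace_exp_lt {X : Matrix n n ℝ} (hX : X.IsSymm) {t : ℝ}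
    (h : (exp X).trace < Real.exp t) {u : n → ℝ} (hu : u ≠ 0) :
    u ⬝ᵥ (X *ᵥ u) < t * (u ⬝ᵥ u) := by
  obtain ⟨U, l, h1, h2, rfl⟩ := exists_eq_mul_diagonal_mul_transpose hX
  rw [exp_mul_diagonal_mul_transpose h1 h2, trace_mul_comm, ← mul_assoc, h1, one_mul,
    trace_diagonal] at h
  have hl : ∀ i, l i < t := fun i => by
    rw [← Real.exp_lt_exp]
    exact (Finset.single_le_sum (f := fun i => Real.exp (l i)) (fun j _ => (Real.exp_pos _).le)
      (Finset.mem_univ i)).trans_lt h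
  have hw : Uᵀ *ᵥ u ≠ 0 := fun h0 => hu <| by
    have : U *ᵥ (Uᵀ *ᵥ u) = u := by rw [mulVec_mulVec, h2, one_mulVec]
    rw [← this, h0, mulVec_zero]
  obtain ⟨i, hi⟩ := Function.ne_iff.1 hw
  rw [dotProduct_mul_diagonal_mul_transpose, dotProduct_self_eq_sum_transpose_mulVec h2,
    Finset.mul_sum]
  refine Finset.sum_lt_sum (fun j _ => mul_le_mul_of_nonneg_right (hl j).le (sq_nonneg _))
    ⟨i, Finset.mem_univ i, mul_lt_mul_of_pos_right (hl i) (by simpa using (sq_pos_of_ne_zero hi))⟩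

end QuadraticForm

/-! ### Laplace transform of a sum of independent symmetric matrices -/

section MatrixLaplace

open Matrix NormedSpace

theorem isSymm_sum {ι n : Type*} (s : Finset ι) (f : ι → Matrix n n ℝ) (h : ∀ i, (f i).IsSymm) :
    (∑ i ∈ s, f i).IsSymm := by
  rw [Matrix.IsSymm, Matrix.transpose_sum]
  exact Finset.sum_congr rfl fun i _ => h i

variable {n : Type*} [Fintype n] [DecidableEq n]

theorem continuous_matrix_exp : Continuous (fun X : Matrix n n ℝ => exp X) := by
  let : NormedRing (Matrix n n ℝ) := Matrix.linftyOpNormedRing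
  let : NormedAlgebra ℝ (Matrix n n ℝ) := Matrix.linftyOpNormedAlgebra
  let : NormedAlgebra ℚ (Matrix n n ℝ) := NormedAlgebra.restrictScalars ℚ ℝ _
  exact NormedSpace.exp_continuous

variable {Ω : Type*} [MeasurableSpace Ω]

theorem measurable_exp_entry {X : Ω → Matrix n n ℝ} (hX : ∀ i j, Measurable fun ω => X ω i j)
    (i j : n) : Measurable fun ω => exp (X ω) i j := by
  have h1 : Measurable (fun ω => (fun i j => X ω i j : n → n → ℝ)) :=
    measurable_pi_lambda _ fun i => measurable_pi_lambda _ fun j => hX i j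
  have h2 : Continuous (fun f : n → n → ℝ => exp (Matrix.of f) i j) :=
    (continuous_apply_apply i j).comp (continuous_matrix_exp.comp continuous_id)
  exact h2.measurable.comp h1

theorem measurable_trace_exp {X : Ω → Matrix n n ℝ} (hX : ∀ i j, Measurable fun ω => X ω i j) :
    Measurable fun ω => (exp (X ω)).trace :=
  Finset.measurable_sum _ fun i _ => measurable_exp_entry hX i i

/-- Almost surely the matrix lies in a compact cube, on which the continuous exponential is bounded.
-/
theorem integrable_exp_entry {μ : Measure Ω} [IsFiniteMeasure μ] {X : Ω → Matrix n n ℝ}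
    (hX : ∀ i j, Measurable fun ω => X ω i j) {b : ℝ} (hb : ∀ᵐ ω ∂μ, ∀ i j, |X ω i j| ≤ b)
    (i j : n) : Integrable (fun ω => exp (X ω) i j) μ := by
  have hK : IsCompact (Set.univ.pi fun _ : n => Set.univ.pi fun _ : n => Set.Icc (-b) b) :=
    isCompact_univ_pi fun _ => isCompact_univ_pi fun _ => isCompact_Icc
  have h2 : Continuous (fun f : n → n → ℝ => exp (Matrix.of f) i j) :=
    (continuous_apply_apply i j).comp (continuous_matrix_exp.comp continuous_id)
  obtain ⟨c, hc⟩ := hK.exists_bound_of_continuousOn h2.continuousOn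
  refine Integrable.of_bound (measurable_exp_entry hX i j).aestronglyMeasurable c ?_
  filter_upwards [hb] with ω hω
  exact hc (X ω) fun i _ j _ => abs_le.1 (hω i j)

/-- The Laplace transform bound of Ahlswede and Winter for sums of independent random matrices. -/
theorem lintegral_trace_exp_sum_le {μ : Measure Ω} [IsProbabilityMeasure μ]
    {X : Ω → Matrix n n ℝ} (hXm : ∀ i j, Measurable fun ω => X ω i j) (hs : ∀ ω, (X ω).IsSymm)
    (hint : ∀ i j, Integrable (fun ω => exp (X ω) i j) μ) {c : ℝ} (hc : 0 ≤ c)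
    (hE : ∀ u, u ⬝ᵥ ((Matrix.of fun i j => ∫ ω, exp (X ω) i j ∂μ) *ᵥ u) ≤ c * (u ⬝ᵥ u)) (N : ℕ)
    {A : Matrix n n ℝ} (hA : A.IsSymm) :
    ∫⁻ ω : Fin N → Ω, ENNReal.ofReal (exp (A + ∑ k, X (ω k))).trace ∂(Measure.pi fun _ => μ)
      ≤ ENNReal.ofReal (c ^ N * (exp A).trace) := by
  induction N generalizing A with
  | zero => simp
  | succ N ih =>
    have hm : Measurable fun ω : Fin (N + 1) → Ω =>
        ENNReal.ofReal (exp (A + ∑ k, X (ω k))).trace := by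
      refine (measurable_trace_exp fun i j => ?_).ennreal_ofReal
      simp only [Matrix.add_apply, Matrix.sum_apply]
      exact measurable_const.add
        (Finset.measurable_sum _ fun k _ => (hXm i j).comp (measurable_pi_apply k))
    have hmp := (measurePreserving_piFinSuccAbove (fun _ : Fin (N + 1) => μ) 0).symm
    rw [← hmp.lintegral_comp hm]
    refine (lintegral_prod _ (hm.comp hmp.measurable).aemeasurable).trans_le ?_
    have hX : ∀ ω, ((exp A) * (exp (X ω))).trace = ∑ i, ∑ j, exp A i j * exp (X ω) j i := fun ω => by
      simp [Matrix.trace, Matrix.mul_apply]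
    have hi : Integrable (fun ω => ((exp A) * (exp (X ω))).trace) μ := by
      simp only [hX]
      exact integrable_finsetSum _ fun i _ => integrable_finsetSum _ fun j _ =>
        (hint j i).const_mul _
    have hpos : ∀ ω, 0 ≤ (exp A * exp (X ω)).trace := fun ω => by
      cases isEmpty_or_nonempty n
      · simp [Matrix.trace]
      · exact (trace_exp_pos (hA.add (hs ω))).le.trans (trace_exp_add_le _ _ hA (hs ω))
    -- Conditionally on the first sample, the induction hypothesis is used with `A + X ω` as the
    -- offset; Golden-Thompson then separates `A` from `X ω`, leaving an expression linear in `exp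
    -- (X ω)` that can be averaged.
    calc _ ≤ ∫⁻ ω, ENNReal.ofReal (c ^ N * (exp A * exp (X ω)).trace) ∂μ := by
          refine lintegral_mono fun ω => ?_
          have := ih (hA.add (hs ω))
          simp only [Function.comp_apply, MeasurableEquiv.piFinSuccAbove_symm_apply,
            Fin.insertNthEquiv_apply, Fin.sum_univ_succ, Fin.insertNth_apply_same]
          refine le_trans (le_of_eq ?_) (this.trans ?_)
          · simp [add_assoc]
          · gcongr
            exact trace_exp_add_le _ _ hA (hs ω)
      _ = ENNReal.ofReal (c ^ N * (exp A * Matrix.of fun i j => ∫ ω, exp (X ω) i j ∂μ).trace) := by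
          rw [← ofReal_integral_eq_lintegral_ofReal (hi.const_mul _)
            (Filter.Eventually.of_forall fun ω => mul_nonneg (pow_nonneg hc _) (hpos ω)),
            integral_const_mul]
          congr 2
          simp only [hX]
          refine (integral_finsetSum _ fun i _ => integrable_finsetSum _ fun j _ =>
            (hint j i).const_mul _).trans ?_
          simp only [Matrix.trace, Matrix.diag_apply, Matrix.mul_apply, Matrix.of_apply]
          refine Finset.sum_congr rfl fun i _ => ?_
          refine (integral_finsetSum _ fun j _ => (hint j i).const_mul _).trans ?_
          simp [integral_const_mul]
      _ ≤ _ := by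
          rw [pow_succ, mul_assoc]
          gcongr
          exact trace_exp_mul_le hA hE

end MatrixLaplace

/-! ### Matrix Bernstein inequality -/

section MatrixBernstein

open Matrix NormedSpace

variable {n : Type*} [Fintype n] {Ω : Type*} [MeasurableSpace Ω]
  {μ : Measure Ω}

/-- The entrywise expectation of a random matrix. -/
noncomputable def matrixMean (μ : Measure Ω) (Y : Ω → Matrix n n ℝ) : Matrix n n ℝ :=
  Matrix.of fun i j => ∫ ω, Y ω i j ∂μ

theorem matrixMean_mulVec {Y : Ω → Matrix n n ℝ} (hY : ∀ i j, Integrable (fun ω => Y ω i j) μ)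
    (u : n → ℝ) (i : n) : (matrixMean μ Y *ᵥ u) i = ∫ ω, (Y ω *ᵥ u) i ∂μ := by
  simp only [Matrix.mulVec, dotProduct]
  rw [integral_finsetSum _ fun j _ => (hY i j).mul_const _]
  simp [matrixMean, integral_mul_const]

theorem integrable_mulVec {Y : Ω → Matrix n n ℝ} (hY : ∀ i j, Integrable (fun ω => Y ω i j) μ)
    (u : n → ℝ) (i : n) : Integrable (fun ω => (Y ω *ᵥ u) i) μ := by
  simp only [Matrix.mulVec, dotProduct]
  exact integrable_finsetSum _ fun j _ => (hY i j).mul_const _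

theorem dotProduct_matrixMean_mulVec {Y : Ω → Matrix n n ℝ}
    (hY : ∀ i j, Integrable (fun ω => Y ω i j) μ) (u w : n → ℝ) :
    w ⬝ᵥ (matrixMean μ Y *ᵥ u) = ∫ ω, w ⬝ᵥ (Y ω *ᵥ u) ∂μ := by
  simp only [dotProduct]
  rw [integral_finsetSum _ fun i _ => (integrable_mulVec hY u i).const_mul _]
  simp only [integral_const_mul, matrixMean_mulVec hY]

theorem abs_entry_le_one [DecidableEq n] {Y : Matrix n n ℝ} {a : ℝ} (ha : a ≤ 1)
    (h : ∀ u, (Y *ᵥ u) ⬝ᵥ (Y *ᵥ u) ≤ a * (u ⬝ᵥ u)) (i j : n) : |Y i j| ≤ 1 := by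
  have h1 := h (Pi.single j 1)
  have h2 : Y i j ^ 2 ≤ (Y *ᵥ Pi.single j 1) ⬝ᵥ (Y *ᵥ Pi.single j 1) := by
    have := Finset.single_le_sum (f := fun i => (Y *ᵥ Pi.single j 1) i * (Y *ᵥ Pi.single j 1) i)
      (fun i _ => mul_self_nonneg _) (Finset.mem_univ i)
    simpa [pow_two, dotProduct] using this
  rw [dotProduct_single, Pi.single_eq_same] at h1
  rw [← sq_le_one_iff_abs_le_one]
  linarith

variable [IsProbabilityMeasure μ] {Y : Ω → Matrix n n ℝ} {a v : ℝ}

theorem sq_mean_le_and_integral_sq_sub_mean_le {f : Ω → ℝ} (hf : MemLp f 2 μ) :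
    (∫ ω, f ω ∂μ) ^ 2 ≤ ∫ ω, f ω ^ 2 ∂μ ∧
      ∫ ω, (f ω - ∫ ω, f ω ∂μ) ^ 2 ∂μ ≤ ∫ ω, f ω ^ 2 ∂μ := by
  have hi : Integrable f μ := hf.integrable (by norm_num)
  have h2 := hf.integrable_sq
  have e : ∫ ω, (f ω - ∫ ω, f ω ∂μ) ^ 2 ∂μ = ∫ ω, f ω ^ 2 ∂μ - (∫ ω, f ω ∂μ) ^ 2 := by
    set m := ∫ ω, f ω ∂μ
    have : ∀ ω, (f ω - m) ^ 2 = f ω ^ 2 - (2 * m) * f ω + m ^ 2 := fun ω => by ring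
    simp only [this]
    have h4 : Integrable (fun ω => f ω ^ 2 - (2 * m) * f ω) μ := h2.sub (hi.const_mul _)
    rw [integral_add h4 (integrable_const _),
      integral_sub h2 (hi.const_mul _), integral_const_mul]
    simp
    ring
  have h3 : 0 ≤ ∫ ω, (f ω - ∫ ω, f ω ∂μ) ^ 2 ∂μ := integral_nonneg fun ω => sq_nonneg _
  constructor
  · linarith
  · rw [e]
    linarith [sq_nonneg (∫ ω, f ω ∂μ)]

variable [DecidableEq n]

/-- The condition `2 * (a + v) ≤ 1` makes the centred matrix X a contraction, so exp X ≤ 1 + X + X²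
as quadratic forms. On averaging, the linear term vanishes and centring does not increase the second
moment. -/
theorem integral_exp_sub_mean_le (hYm : ∀ i j, Measurable fun ω => Y ω i j)
    (hs : ∀ ω, (Y ω).IsSymm) (ha : ∀ᵐ ω ∂μ, ∀ u, (Y ω *ᵥ u) ⬝ᵥ (Y ω *ᵥ u) ≤ a * (u ⬝ᵥ u))
    (hv : ∀ u, ∫ ω, (Y ω *ᵥ u) ⬝ᵥ (Y ω *ᵥ u) ∂μ ≤ v * (u ⬝ᵥ u)) (hv0 : 0 ≤ v) (hav : 2 * (a + v) ≤ 1) :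
    (∀ i j, Integrable (fun ω => exp (Y ω - matrixMean μ Y) i j) μ) ∧
    ∀ u, u ⬝ᵥ ((Matrix.of fun i j => ∫ ω, exp (Y ω - matrixMean μ Y) i j ∂μ) *ᵥ u)
      ≤ (1 + v) * (u ⬝ᵥ u) := by
  have hb : ∀ᵐ ω ∂μ, ∀ i j, |Y ω i j| ≤ 1 := by
    filter_upwards [ha] with ω hω i j using abs_entry_le_one (by linarith) hω i j
  have hL : ∀ i j, MemLp (fun ω => Y ω i j) 2 μ := fun i j =>
    MemLp.of_bound (hYm i j).aestronglyMeasurable 1 (by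
      filter_upwards [hb] with ω hω using hω i j)
  have hY : ∀ i j, Integrable (fun ω => Y ω i j) μ := fun i j => (hL i j).integrable (by norm_num)
  have hLu : ∀ u i, MemLp (fun ω => (Y ω *ᵥ u) i) 2 μ := fun u i => by
    simp only [Matrix.mulVec, dotProduct]
    exact memLp_finsetSum _ fun j _ => (hL i j).mul_const _
  -- Jensen: the mean inherits the second moment bound v, not just the almost sure bound a.
  have hm : ∀ u, (matrixMean μ Y *ᵥ u) ⬝ᵥ (matrixMean μ Y *ᵥ u) ≤ v * (u ⬝ᵥ u) := fun u => by
    refine le_trans ?_ (hv u)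
    simp only [dotProduct, ← pow_two]
    rw [integral_finsetSum _ fun i _ => (hLu u i).integrable_sq]
    refine Finset.sum_le_sum fun i _ => ?_
    rw [matrixMean_mulVec hY]
    exact (sq_mean_le_and_integral_sq_sub_mean_le (hLu u i)).1
  set X : Ω → Matrix n n ℝ := fun ω => Y ω - matrixMean μ Y with hX
  have hXi : ∀ u i ω, (X ω *ᵥ u) i = (Y ω *ᵥ u) i - ∫ ω, (Y ω *ᵥ u) i ∂μ := fun u i ω => by
    rw [hX, Matrix.sub_mulVec, Pi.sub_apply, matrixMean_mulVec hY]
  have hXm : ∀ i j, Measurable fun ω => X ω i j := fun i j => (hYm i j).sub_const _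
  have hXI : ∀ i j, Integrable (fun ω => X ω i j) μ := fun i j => (hY i j).sub (integrable_const _)
  have hXs : ∀ ω, (X ω).IsSymm := fun ω => (hs ω).sub (by
    ext i j
    simp only [matrixMean, Matrix.transpose_apply, Matrix.of_apply]
    exact integral_congr_ae (Filter.Eventually.of_forall fun ω => (hs ω).apply _ _))
  have hX1 : ∀ᵐ ω ∂μ, ∀ u, (X ω *ᵥ u) ⬝ᵥ (X ω *ᵥ u) ≤ 1 * (u ⬝ᵥ u) := by
    filter_upwards [ha] with ω hω u
    have h1 : (X ω *ᵥ u) ⬝ᵥ (X ω *ᵥ u) ≤ 2 * ((Y ω *ᵥ u) ⬝ᵥ (Y ω *ᵥ u))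
        + 2 * ((matrixMean μ Y *ᵥ u) ⬝ᵥ (matrixMean μ Y *ᵥ u)) := by
      rw [hX]
      simp only [Matrix.sub_mulVec, dotProduct, Pi.sub_apply]
      rw [Finset.mul_sum, Finset.mul_sum, ← Finset.sum_add_distrib]
      refine Finset.sum_le_sum fun i _ => ?_
      nlinarith [sq_nonneg ((Y ω *ᵥ u) i + (matrixMean μ Y *ᵥ u) i)]
    have h2 : 0 ≤ u ⬝ᵥ u := Finset.sum_nonneg fun i _ => mul_self_nonneg _
    nlinarith [hω u, hm u]
  have hint := integrable_exp_entry hXm (b := 1) (by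
    filter_upwards [hX1] with ω hω i j using abs_entry_le_one le_rfl hω i j)
  refine ⟨hint, fun u => ?_⟩
  have hLX : ∀ i, MemLp (fun ω => (X ω *ᵥ u) i) 2 μ := fun i => by
    simp only [hXi]
    exact (hLu u i).sub (memLp_const _)
  have hsq : ∫ ω, (X ω *ᵥ u) ⬝ᵥ (X ω *ᵥ u) ∂μ ≤ v * (u ⬝ᵥ u) := by
    refine le_trans ?_ (hv u)
    simp only [dotProduct, ← pow_two]
    rw [integral_finsetSum _ fun i _ => (hLu u i).integrable_sq,
      integral_finsetSum _ fun i _ => (hLX i).integrable_sq]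
    refine Finset.sum_le_sum fun i _ => ?_
    simp only [hXi]
    exact (sq_mean_le_and_integral_sq_sub_mean_le (hLu u i)).2
  have hsqi : Integrable (fun ω => (X ω *ᵥ u) ⬝ᵥ (X ω *ᵥ u)) μ := by
    simp only [dotProduct, ← pow_two]
    exact integrable_finsetSum _ fun i _ => (hLX i).integrable_sq
  have hlin : ∫ ω, u ⬝ᵥ (X ω *ᵥ u) ∂μ = 0 := by
    rw [← dotProduct_matrixMean_mulVec hXI]
    have : matrixMean μ X = 0 := by
      ext i j
      simp only [matrixMean, hX, Matrix.of_apply, Matrix.sub_apply]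
      rw [integral_sub (hY i j) (integrable_const _)]
      simp
    simp [this]
  have hlini : Integrable (fun ω => u ⬝ᵥ (X ω *ᵥ u)) μ := by
    simp only [dotProduct]
    exact integrable_finsetSum _ fun i _ => (integrable_mulVec hXI u i).const_mul _
  have he := dotProduct_matrixMean_mulVec hint u u
  rw [matrixMean] at he
  rw [he]
  calc ∫ ω, u ⬝ᵥ (exp (X ω) *ᵥ u) ∂μ
      ≤ ∫ ω, (u ⬝ᵥ u + u ⬝ᵥ (X ω *ᵥ u) + (X ω *ᵥ u) ⬝ᵥ (X ω *ᵥ u)) ∂μ := by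
        refine integral_mono_ae ?_ (((integrable_const _).add hlini).add hsqi) ?_
        · simp only [dotProduct]
          exact integrable_finsetSum _ fun i _ => (integrable_mulVec hint u i).const_mul _
        · filter_upwards [hX1] with ω hω
          exact dotProduct_exp_mulVec_le (hXs ω) (fun w => by simpa using hω w) u
    _ = u ⬝ᵥ u + ∫ ω, (X ω *ᵥ u) ⬝ᵥ (X ω *ᵥ u) ∂μ := by
        have h4 : Integrable (fun ω => u ⬝ᵥ u + u ⬝ᵥ (X ω *ᵥ u)) μ :=
          (integrable_const _).add hlini
        rw [integral_add h4 hsqi,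
          integral_add (integrable_const _) hlini, hlin]
        simp
    _ ≤ _ := by linarith

/-- A one-sided matrix Bernstein inequality for the sum of independent copies of a random symmetric
matrix. -/
theorem measure_exists_le_dotProduct_sum_le (hYm : ∀ i j, Measurable fun ω => Y ω i j)
    (hs : ∀ ω, (Y ω).IsSymm) (ha : ∀ᵐ ω ∂μ, ∀ u, (Y ω *ᵥ u) ⬝ᵥ (Y ω *ᵥ u) ≤ a * (u ⬝ᵥ u))
    (hv : ∀ u, ∫ ω, (Y ω *ᵥ u) ⬝ᵥ (Y ω *ᵥ u) ∂μ ≤ v * (u ⬝ᵥ u)) (hv0 : 0 ≤ v)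
    (hav : 2 * (a + v) ≤ 1) (N : ℕ) (t : ℝ) :
    (Measure.pi fun _ : Fin N => μ)
      {ω | ∃ u, u ≠ 0 ∧ t * (u ⬝ᵥ u) ≤ u ⬝ᵥ ((∑ k, (Y (ω k) - matrixMean μ Y)) *ᵥ u)}
      ≤ ENNReal.ofReal (Fintype.card n * Real.exp (N * v - t)) := by
  obtain ⟨hint, hE⟩ := integral_exp_sub_mean_le hYm hs ha hv hv0 hav
  have hXs : ∀ ω, (Y ω - matrixMean μ Y).IsSymm := fun ω => (hs ω).sub (by
    ext i j
    simp only [matrixMean, Matrix.transpose_apply, Matrix.of_apply]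
    exact integral_congr_ae (Filter.Eventually.of_forall fun ω => (hs ω).apply _ _))
  have hXm : ∀ i j, Measurable fun ω => (Y ω - matrixMean μ Y) i j :=
    fun i j => (hYm i j).sub_const _
  have h1 := lintegral_trace_exp_sum_le (μ := μ) hXm hXs hint (by linarith : 0 ≤ 1 + v) hE N
    (A := 0) (by simp [Matrix.IsSymm])
  simp only [zero_add, NormedSpace.exp_zero, Matrix.trace_one] at h1
  have hm : Measurable fun ω : Fin N → Ω =>
      ENNReal.ofReal (exp (∑ k, (Y (ω k) - matrixMean μ Y))).trace := by
    refine (measurable_trace_exp fun i j => ?_).ennreal_ofReal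
    simp only [Matrix.sum_apply]
    exact Finset.measurable_sum _ fun k _ => (hXm i j).comp (measurable_pi_apply k)
  refine (measure_mono (t := {ω | ENNReal.ofReal (Real.exp t) ≤
    ENNReal.ofReal (exp (∑ k, (Y (ω k) - matrixMean μ Y))).trace}) ?_).trans ?_
  · rintro ω ⟨u, hu, hut⟩
    refine ENNReal.ofReal_le_ofReal (le_of_not_gt fun hlt => ?_)
    exact absurd hut (not_le.2 (dotProduct_mulVec_lt_of_trace_exp_lt
      (isSymm_sum _ _ fun k => hXs (ω k)) hlt hu))
  -- Markov's inequality for tr exp, where the offset 0 contributes tr 1, the dimension; finally (1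
  -- + v)^N ≤ e^{Nv}.
  · refine (meas_ge_le_lintegral_div hm.aemeasurable (by simp [Real.exp_pos]) (by simp)).trans ?_
    refine (ENNReal.div_le_div_right h1 _).trans ?_
    rw [← ENNReal.ofReal_div_of_pos (Real.exp_pos t)]
    refine ENNReal.ofReal_le_ofReal ?_
    rw [Real.exp_sub, mul_comm ((1 + v) ^ N), mul_div_assoc, Real.exp_nat_mul]
    gcongr
    linarith [Real.add_one_le_exp v]

end MatrixBernstein

/-! ### Weyl-type inequalities and rank recovery by thresholding -/

section SingularValuePerturbation

open Module

variable {E F : Type*} [NormedAddCommGroup E] [InnerProductSpace ℝ E] [FiniteDimensional ℝ E]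
  [NormedAddCommGroup F] [InnerProductSpace ℝ F] [FiniteDimensional ℝ F]

/-- An orthonormal basis of right singular vectors. -/
theorem exists_orthonormalBasis_norm_sq_apply (T : E →ₗ[ℝ] F) :
    ∃ b : OrthonormalBasis (Fin (finrank ℝ E)) ℝ E, ∀ v,
      ‖T v‖ ^ 2 = ∑ j : Fin (finrank ℝ E), T.singularValues j ^ 2 * (inner ℝ (b j) v) ^ 2 := by
  have hT := T.isSymmetric_adjoint_comp_self
  refine ⟨hT.eigenvectorBasis rfl, fun v => ?_⟩
  set b := hT.eigenvectorBasis rfl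
  have h1 : ‖T v‖ ^ 2 = inner ℝ v ((T.adjoint ∘ₗ T) v) := by
    rw [LinearMap.comp_apply, LinearMap.adjoint_inner_right, real_inner_self_eq_norm_sq]
  rw [h1, ← b.sum_inner_mul_inner]
  refine Finset.sum_congr rfl fun j _ => ?_
  have h2 := hT.eigenvectorBasis_apply_self_apply rfl v j
  rw [OrthonormalBasis.repr_apply_apply, OrthonormalBasis.repr_apply_apply] at h2
  rw [h2, T.sq_singularValues_fin rfl, real_inner_comm]
  simp only [RCLike.ofReal_real_eq_id, id_eq]
  ring

/-- An upper Weyl inequality at the rank of the unperturbed map. -/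
theorem singularValues_finrank_range_lt (T T₀ : E →ₗ[ℝ] F) {β : ℝ} (hβ : 0 < β)
    (hE : ∀ v, v ≠ 0 → ‖T v - T₀ v‖ < β * ‖v‖) :
    T.singularValues (finrank ℝ T₀.range) < β := by
  set d := finrank ℝ T₀.range with hd
  by_contra! hcon
  have hdn : d < finrank ℝ E := by
    by_contra! h
    rw [T.singularValues_of_finrank_le h] at hcon
    linarith
  obtain ⟨b, hb⟩ := exists_orthonormalBasis_norm_sq_apply T
  -- Singular values are indexed from 0 here. The target has dimension (n - d - 1) + d = n - 1 with
  -- n = dim E, so a non-zero v in ker T₀ lies in the span of the top d + 1 right singular vectors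
  -- of T. There ‖T v‖ ≥ β‖v‖, although T v is pure perturbation.
  let f : E →ₗ[ℝ] ({j : Fin (finrank ℝ E) // d < j} → ℝ) × T₀.range :=
    (LinearMap.pi fun j => (innerₛₗ ℝ (b j.1))).prod T₀.rangeRestrict
  have hcard : Fintype.card {j : Fin (finrank ℝ E) // d < j} = finrank ℝ E - d - 1 := by
    rw [Fintype.card_subtype]
    have : (Finset.univ.filter fun j : Fin (finrank ℝ E) => d < j) = Finset.Ioi ⟨d, hdn⟩ := by
      ext j; simp [Fin.lt_def]
    rw [this, Fin.card_Ioi]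
    simp only
    omega
  have hk : LinearMap.ker f ≠ ⊥ := LinearMap.ker_ne_bot_of_finrank_lt (by
    rw [finrank_prod, finrank_fintype_fun_eq_card, hcard]
    omega)
  obtain ⟨v, hv, hv0⟩ := Submodule.exists_mem_ne_zero_of_ne_bot hk
  have hv' : f v = 0 := hv
  have h1 : ∀ j : Fin (finrank ℝ E), d < j → inner ℝ (b j) v = 0 := fun j hj =>
    congrFun (congrArg Prod.fst hv') ⟨j, hj⟩
  have h2 : T₀ v = 0 := congrArg Subtype.val (congrArg Prod.snd hv')
  have h3 := hE v hv0
  rw [h2, sub_zero] at h3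
  refine absurd h3 (not_lt.2 ((sq_le_sq₀ (by positivity) (by positivity)).1 ?_))
  rw [hb, mul_pow, ← b.sum_sq_norm_inner_right v, Finset.mul_sum]
  refine Finset.sum_le_sum fun j _ => ?_
  rw [Real.norm_eq_abs, sq_abs]
  by_cases hj : d < j
  · simp [h1 j hj]
  · have := T.singularValues_antitone (not_lt.1 hj)
    gcongr
    exact hcon.trans this

/-- A lower Weyl inequality at the rank of the unperturbed map. -/
theorem le_singularValues_finrank_range_sub_one (T T₀ : E →ₗ[ℝ] F) {β : ℝ} (hβ : 0 < β)
    (hE : ∀ v, v ≠ 0 → ‖T v - T₀ v‖ < β * ‖v‖) (h0 : 0 < finrank ℝ T₀.range)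
    (hσ : 2 * β ≤ T₀.singularValues (finrank ℝ T₀.range - 1)) :
    β ≤ T.singularValues (finrank ℝ T₀.range - 1) := by
  set d := finrank ℝ T₀.range with hd
  by_contra! hcon
  have hdn : d ≤ finrank ℝ E := T₀.finrank_range_le
  obtain ⟨b, hb⟩ := exists_orthonormalBasis_norm_sq_apply T
  obtain ⟨b₀, hb₀⟩ := exists_orthonormalBasis_norm_sq_apply T₀
  -- Again there are (d - 1) + (n - d) = n - 1 constraints: v avoids the top d - 1 directions of T
  -- and lies in the top d directions of T₀. Then ‖T v‖ ≤ β‖v‖ and ‖T₀ v‖ ≥ 2β‖v‖, too far apart for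
  -- the perturbation.
  let f : E →ₗ[ℝ] ({j : Fin (finrank ℝ E) // j < d - 1} → ℝ) ×
      ({j : Fin (finrank ℝ E) // ¬ j < d} → ℝ) :=
    (LinearMap.pi fun j => (innerₛₗ ℝ (b j.1))).prod (LinearMap.pi fun j => (innerₛₗ ℝ (b₀ j.1)))
  have hcard : ∀ m ≤ finrank ℝ E, Fintype.card {j : Fin (finrank ℝ E) // j < m} = m := by
    intro m hm
    rw [Fintype.card_subtype]
    exact Fin.card_filter_val_lt.trans (min_eq_right hm)
  have hk : LinearMap.ker f ≠ ⊥ := LinearMap.ker_ne_bot_of_finrank_lt (by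
    rw [finrank_prod, finrank_fintype_fun_eq_card, finrank_fintype_fun_eq_card,
      Fintype.card_subtype_compl, hcard _ (by omega), hcard _ hdn, Fintype.card_fin]
    omega)
  obtain ⟨v, hv, hv0⟩ := Submodule.exists_mem_ne_zero_of_ne_bot hk
  have hv' : f v = 0 := hv
  have h1 : ∀ j : Fin (finrank ℝ E), j < d - 1 → inner ℝ (b j) v = 0 := fun j hj =>
    congrFun (congrArg Prod.fst hv') ⟨j, hj⟩
  have h2 : ∀ j : Fin (finrank ℝ E), ¬ j < d → inner ℝ (b₀ j) v = 0 := fun j hj =>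
    congrFun (congrArg Prod.snd hv') ⟨j, hj⟩
  have h3 : ‖T v‖ ≤ β * ‖v‖ := by
    refine (sq_le_sq₀ (by positivity) (by positivity)).1 ?_
    rw [hb, mul_pow, ← b.sum_sq_norm_inner_right v, Finset.mul_sum]
    refine Finset.sum_le_sum fun j _ => ?_
    rw [Real.norm_eq_abs, sq_abs]
    by_cases hj : (j : ℕ) < d - 1
    · simp [h1 j hj]
    · have h4 := T.singularValues_antitone (not_lt.1 hj)
      have h5 := T.singularValues_nonneg j
      gcongr
      exact h4.trans hcon.le
  have h4 : 2 * β * ‖v‖ ≤ ‖T₀ v‖ := by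
    refine (sq_le_sq₀ (by positivity) (by positivity)).1 ?_
    rw [hb₀, mul_pow, ← b₀.sum_sq_norm_inner_right v, Finset.mul_sum]
    refine Finset.sum_le_sum fun j _ => ?_
    rw [Real.norm_eq_abs, sq_abs]
    by_cases hj : (j : ℕ) < d
    · have h4 := T₀.singularValues_antitone (show (j : ℕ) ≤ d - 1 by omega)
      gcongr
      exact hσ.trans h4
    · simp [h2 j hj]
  have h5 := hE v hv0
  have h6 := norm_sub_norm_le (T₀ v) (T v)
  rw [norm_sub_rev] at h6
  linarith

theorem rank_eq_finrank_range_toEuclideanLin {S A : ℕ} (Q : Matrix (Fin S) (Fin A) ℝ) :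
    Q.rank = finrank ℝ (Matrix.toEuclideanLin Q).range := by
  rw [Matrix.toEuclideanLin_eq_toLin_orthonormal]
  exact Matrix.rank_eq_finrank_range_toLin Q _ _

theorem rank_pos_of_ne_zero {S A : ℕ} {Q : Matrix (Fin S) (Fin A) ℝ} (hQ : Q ≠ 0) :
    0 < Q.rank := Nat.pos_of_ne_zero fun h => hQ (by
  rw [rank_eq_finrank_range_toEuclideanLin, Submodule.finrank_eq_zero,
    LinearMap.range_eq_bot] at h
  simpa using h)

/-- By monotonicity the counted indices form an initial segment; the two Weyl bounds place its end
at the rank. -/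
theorem thresholdRank_eq_rank {S A : ℕ} (B Q : Matrix (Fin S) (Fin A) ℝ) (hQ : Q ≠ 0) {β : ℝ}
    (hβ : 0 < β)
    (hE : ∀ v : EuclideanSpace ℝ (Fin A), v ≠ 0 →
      ‖Matrix.toEuclideanLin (B - Q) v‖ < β * ‖v‖)
    (hσ : 2 * β ≤ singularValue Q Q.rank) : thresholdRank B β = Q.rank := by
  have hr := rank_eq_finrank_range_toEuclideanLin Q
  have hE' : ∀ v, v ≠ 0 → ‖Matrix.toEuclideanLin B v - Matrix.toEuclideanLin Q v‖ < β * ‖v‖ := by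
    intro v hv
    have := hE v hv
    rwa [map_sub, LinearMap.sub_apply] at this
  have h0 := rank_pos_of_ne_zero hQ
  have hup := singularValues_finrank_range_lt _ _ hβ hE'
  rw [← hr] at hup
  have hlow := le_singularValues_finrank_range_sub_one _ _ hβ hE' (hr ▸ h0) (by
    rw [← hr]; exact hσ)
  rw [← hr] at hlow
  have hle : Q.rank ≤ min S A := le_min (by simpa using Q.rank_le_height) Q.rank_le_width
  have : ({i ∈ Finset.Icc 1 (min S A) | β ≤ singularValue B i} : Finset ℕ) = Finset.Icc 1 Q.rank := by
    ext i
    rw [Finset.mem_filter, Finset.mem_Icc, Finset.mem_Icc]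
    simp only [singularValue]
    constructor
    · rintro ⟨⟨h1, h2⟩, h3⟩
      refine ⟨h1, ?_⟩
      by_contra! h4
      have := (Matrix.toEuclideanLin B).singularValues_antitone (show Q.rank ≤ i - 1 by omega)
      linarith
    · rintro ⟨h1, h2⟩
      refine ⟨⟨h1, h2.trans hle⟩, hlow.trans ?_⟩
      exact (Matrix.toEuclideanLin B).singularValues_antitone (by omega)
  rw [thresholdRank, this]
  simp

end SingularValuePerturbation

/-! ### Almost sure properties of trajectories and the truncation bias -/

section Trajectories

open Preorder

variable {Z : Type*} [MeasurableSpace Z]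
  {κ : (n : ℕ) → Kernel (Π _ : Finset.Iic n, Z) Z} [∀ n, IsMarkovKernel (κ n)]
  {μ₀ : Measure Z}

theorem ae_trajMeasure_zero {p : Z → Prop} (hp : MeasurableSet {x | p x})
    (h : ∀ᵐ x ∂μ₀, p x) :
    ∀ᵐ ω ∂(Kernel.trajMeasure (X := fun _ => Z) μ₀ κ), p (ω 0) := by
  have h1 : (Kernel.trajMeasure (X := fun _ => Z) μ₀ κ).map (frestrictLe 0) =
      μ₀.map (MeasurableEquiv.piUnique (fun _ : Finset.Iic 0 => Z)).symm := by
    rw [Kernel.trajMeasure, Measure.map_comp _ _ (by fun_prop), Kernel.traj_map_frestrictLe,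
      Kernel.partialTraj_self, Measure.id_comp]
  have h2 : ∀ᵐ x ∂(Kernel.trajMeasure (X := fun _ => Z) μ₀ κ).map (frestrictLe 0),
      p (x ⟨0, Finset.mem_Iic.2 le_rfl⟩) := by
    rw [h1]
    exact (ae_map_iff (MeasurableEquiv.measurable _).aemeasurable
      (measurable_pi_apply (⟨0, Finset.mem_Iic.2 le_rfl⟩ : Finset.Iic 0) hp)).2 h
  exact ae_of_ae_map (f := frestrictLe (π := fun _ => Z) 0)
    (measurable_frestrictLe 0).aemeasurable h2

/-- The joint law of the past and the next step is a composition product with `κ a`, so a property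
holding under every `κ a x` holds almost surely. -/
theorem ae_trajMeasure_succ [IsProbabilityMeasure μ₀] {a : ℕ} {p : Z → Prop} (hp : MeasurableSet {x | p x})
    (h : ∀ x, ∀ᵐ y ∂(κ a x), p y) :
    ∀ᵐ ω ∂(Kernel.trajMeasure (X := fun _ => Z) μ₀ κ), p (ω (a + 1)) := by
  have h1 := Kernel.map_frestrictLe_trajMeasure_compProd_eq_map_trajMeasure
    (X := fun _ => Z) (κ := κ) (μ₀ := μ₀) (a := a)
  have h2 : ∀ᵐ z ∂((Kernel.trajMeasure (X := fun _ => Z) μ₀ κ).map (frestrictLe a) ⊗ₘ κ a),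
      p z.2 :=
    Measure.ae_compProd_of_ae_ae (measurable_snd hp) (Filter.Eventually.of_forall h)
  rw [h1] at h2
  exact ae_of_ae_map (f := fun x : ℕ → Z => (frestrictLe (π := fun _ => Z) a x, x (a + 1)))
    ((measurable_frestrictLe a).prodMk (measurable_pi_apply _)).aemeasurable h2

variable {S A : ℕ} (M : MDP S A) (π : Policy S A) {rmax γ : ℝ}

theorem MDP.ae_emit_reward (hM : M.RewardBoundedBy rmax) (sa : Fin S × Fin A) :
    ∀ᵐ z ∂(M.emit sa), |z.2.2| ≤ rmax := by
  rw [MDP.emit, ae_map_iff (by fun_prop)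
    (measurableSet_le (by fun_prop) measurable_const)]
  exact hM sa.1 sa.2

theorem MDP.ae_next_reward (hM : M.RewardBoundedBy rmax) (sa : Fin S × Fin A) :
    ∀ᵐ z ∂(M.next π sa), |z.2.2| ≤ rmax := by
  rw [ae_iff, MDP.next]
  simp only [Measure.finsetSum_apply, Measure.smul_apply, smul_eq_mul]
  refine Finset.sum_eq_zero fun s _ => Finset.sum_eq_zero fun a _ => ?_
  rw [ae_iff.1 (M.ae_emit_reward hM (s, a)), mul_zero]

theorem MDP.ae_trajLaw_reward (hM : M.RewardBoundedBy rmax) (s : Fin S) (a : Fin A) :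
    ∀ᵐ ω ∂(M.trajLaw π s a), ∀ t, |(ω t).2.2| ≤ rmax := by
  rw [ae_all_iff]
  have hp : MeasurableSet {z : Transition S A | |z.2.2| ≤ rmax} :=
    measurableSet_le (by fun_prop) measurable_const
  intro t
  cases t with
  | zero => exact ae_trajMeasure_zero (p := fun z : Transition S A => |z.2.2| ≤ rmax) hp (M.ae_emit_reward hM _)
  | succ t =>
    refine ae_trajMeasure_succ (p := fun z : Transition S A => |z.2.2| ≤ rmax) hp fun x => ?_
    rw [MDP.stepKernel, Kernel.comap_apply]
    exact M.ae_next_reward π hM _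

theorem MDP.ae_trajLaw_start (s : Fin S) (a : Fin A) :
    ∀ᵐ ω ∂(M.trajLaw π s a), (ω 0).1 = s ∧ (ω 0).2.1 = a := by
  have hp : MeasurableSet {z : Transition S A | z.1 = s ∧ z.2.1 = a} :=
    (measurableSet_eq_fun measurable_fst measurable_const).inter
      (measurableSet_eq_fun (measurable_fst.comp measurable_snd) measurable_const)
  refine ae_trajMeasure_zero (p := fun z : Transition S A => z.1 = s ∧ z.2.1 = a) hp ?_
  rw [MDP.emit, ae_map_iff (by fun_prop) hp]
  simp

/-- The discounted return of the first `τ + 1` steps. -/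
noncomputable def truncatedReturn (γ : ℝ) (τ : ℕ) (ω : ℕ → Transition S A) : ℝ :=
  ∑ t ∈ Finset.range (τ + 1), γ ^ t * (ω t).2.2

theorem measurable_truncatedReturn (γ : ℝ) (τ : ℕ) :
    Measurable (truncatedReturn (S := S) (A := A) γ τ) :=
  Finset.measurable_sum _ fun t _ => by fun_prop

theorem abs_truncatedReturn_le (h0 : 0 ≤ γ) (h1 : γ < 1) (τ : ℕ) {ω : ℕ → Transition S A}
    (hω : ∀ t, |(ω t).2.2| ≤ rmax) : |truncatedReturn γ τ ω| ≤ rmax / (1 - γ) := by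
  have hr : 0 ≤ rmax := (abs_nonneg _).trans (hω 0)
  calc |truncatedReturn γ τ ω| ≤ ∑ t ∈ Finset.range (τ + 1), γ ^ t * rmax := by
        refine (Finset.abs_sum_le_sum_abs _ _).trans (Finset.sum_le_sum fun t _ => ?_)
        rw [abs_mul, abs_of_nonneg (pow_nonneg h0 t)]
        exact mul_le_mul_of_nonneg_left (hω t) (pow_nonneg h0 t)
    _ = (∑ t ∈ Finset.range (τ + 1), γ ^ t) * rmax := (Finset.sum_mul _ _ _).symm
    _ ≤ (1 - γ)⁻¹ * rmax := by
        gcongr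
        rw [← tsum_geometric_of_lt_one h0 h1]
        exact (summable_geometric_of_lt_one h0 h1).sum_le_tsum _ fun t _ => pow_nonneg h0 t
    _ = rmax / (1 - γ) := by ring

/-- The expected truncated return. -/
noncomputable def MDP.truncatedQ (γ : ℝ) (τ : ℕ) : Matrix (Fin S) (Fin A) ℝ :=
  Matrix.of fun s a => ∫ ω, truncatedReturn γ τ ω ∂(M.trajLaw π s a)

/-- Bounded rewards and γ < 1 allow exchanging series and expectation; what remains is a geometric
tail. -/
theorem MDP.abs_Q_sub_truncatedQ_le (hM : M.RewardBoundedBy rmax) (h0 : 0 ≤ γ) (h1 : γ < 1)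
    (τ : ℕ) (s : Fin S) (a : Fin A) :
    |M.Q π γ s a - M.truncatedQ π γ τ s a| ≤ γ ^ (τ + 1) * (rmax / (1 - γ)) := by
  have hae := M.ae_trajLaw_reward π hM s a
  have hb : ∀ t, ∀ᵐ ω ∂(M.trajLaw π s a), ‖γ ^ t * (ω t).2.2‖ ≤ γ ^ t * rmax := fun t => by
    filter_upwards [hae] with ω hω
    rw [norm_mul, Real.norm_of_nonneg (pow_nonneg h0 t), Real.norm_eq_abs]
    exact mul_le_mul_of_nonneg_left (hω t) (pow_nonneg h0 t)
  have hi : ∀ t, Integrable (fun ω : ℕ → Transition S A => γ ^ t * (ω t).2.2)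
      (M.trajLaw π s a) := fun t =>
    Integrable.of_bound (Measurable.aestronglyMeasurable (by fun_prop)) _ (hb t)
  have hnorm : ∀ t, ∫ ω, ‖γ ^ t * (ω t).2.2‖ ∂(M.trajLaw π s a) ≤ γ ^ t * rmax := fun t => by
    simpa using integral_mono_ae (hi t).norm (integrable_const _) (hb t)
  have hgeo : Summable fun t => γ ^ t * rmax := (summable_geometric_of_lt_one h0 h1).mul_right _
  have hs : Summable fun t => ∫ ω, ‖γ ^ t * (ω t).2.2‖ ∂(M.trajLaw π s a) :=
    Summable.of_nonneg_of_le (fun t => integral_nonneg fun ω => norm_nonneg _) hnorm hgeo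
  have hsum := hasSum_integral_of_summable_integral_norm hi hs
  have hQ : M.Q π γ s a = ∑' t, ∫ ω, γ ^ t * (ω t).2.2 ∂(M.trajLaw π s a) := hsum.tsum_eq.symm
  have hT : M.truncatedQ π γ τ s a
      = ∑ t ∈ Finset.range (τ + 1), ∫ ω, γ ^ t * (ω t).2.2 ∂(M.trajLaw π s a) := by
    simp only [MDP.truncatedQ, Matrix.of_apply, truncatedReturn]
    exact integral_finsetSum _ fun t _ => hi t
  rw [hQ, hT, ← hsum.summable.sum_add_tsum_nat_add (τ + 1), add_sub_cancel_left]
  have hgeo' : HasSum (fun t => γ ^ (t + (τ + 1)) * rmax) (γ ^ (τ + 1) * (rmax / (1 - γ))) := by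
    have := ((hasSum_geometric_of_lt_one h0 h1).mul_left (γ ^ (τ + 1))).mul_right rmax
    convert! this using 1
    · ext t; ring
    · ring
  exact tsum_of_norm_bounded hgeo' fun t =>
    (norm_integral_le_integral_norm _).trans (hnorm _)

theorem MDP.unifLaw_ae {p : (ℕ → Transition S A) → Prop}
    (h : ∀ s a, ∀ᵐ ω ∂(M.trajLaw π s a), p ω) : ∀ᵐ ω ∂(M.unifLaw π), p ω := by
  rw [ae_iff, MDP.unifLaw]
  simp only [Measure.smul_apply, Measure.finsetSum_apply, smul_eq_mul]
  rw [Finset.sum_eq_zero fun s _ => Finset.sum_eq_zero fun a _ => ae_iff.1 (h s a), mul_zero]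

theorem MDP.isProbabilityMeasure_unifLaw (hS : 0 < S) (hA : 0 < A) :
    IsProbabilityMeasure (M.unifLaw π) := by
  constructor
  have : ((S : ℝ≥0∞) * A) ≠ 0 := by
    simp [hS.ne', hA.ne']
  simp [MDP.unifLaw]
  exact ENNReal.inv_mul_cancel this (by finiteness)

theorem MDP.integral_unifLaw {f : (ℕ → Transition S A) → ℝ}
    (hf : ∀ s a, Integrable f (M.trajLaw π s a)) :
    ∫ ω, f ω ∂(M.unifLaw π) = ((S : ℝ) * A)⁻¹ * ∑ s, ∑ a, ∫ ω, f ω ∂(M.trajLaw π s a) := by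
  rw [MDP.unifLaw, integral_smul_measure, integral_finsetSum_measure]
  · simp only [integral_finsetSum_measure fun a _ => hf _ a]
    simp
  · exact fun s _ => integrable_finsetSum_measure.2 fun a _ => hf s a

end Trajectories

/-! ### Concentration of the empirical value matrix -/

section Concentration

open Matrix

variable {S A : ℕ}

/-- The Hermitian dilation of a real rectangular matrix. -/
def dilation (Z : Matrix (Fin S) (Fin A) ℝ) : Matrix (Fin S ⊕ Fin A) (Fin S ⊕ Fin A) ℝ :=
  Matrix.fromBlocks 0 Z Zᵀ 0

theorem dilation_isSymm (Z : Matrix (Fin S) (Fin A) ℝ) : (dilation Z).IsSymm := by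
  simp [dilation, Matrix.IsSymm, Matrix.fromBlocks_transpose]

theorem dilation_mulVec (Z : Matrix (Fin S) (Fin A) ℝ) (x : Fin S → ℝ) (y : Fin A → ℝ) :
    dilation Z *ᵥ Sum.elim x y = Sum.elim (Z *ᵥ y) (Zᵀ *ᵥ x) := by
  simp [dilation, Matrix.fromBlocks_mulVec]

/-- A one-sided bound on the quadratic form of the dilation bounds the operator norm. -/
theorem mulVec_dotProduct_self_lt_of_dilation {D : Matrix (Fin S) (Fin A) ℝ} {t : ℝ} (ht : 0 < t)
    (h : ∀ u, u ≠ 0 → u ⬝ᵥ (dilation D *ᵥ u) < t * (u ⬝ᵥ u)) {v : Fin A → ℝ} (hv : v ≠ 0) :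
    (D *ᵥ v) ⬝ᵥ (D *ᵥ v) < t ^ 2 * (v ⬝ᵥ v) := by
  -- This choice gives 2 t⁻¹‖Dv‖² < t⁻¹‖Dv‖² + t‖v‖². No lower tail is needed, because the spectrum
  -- of a dilation is symmetric about 0.
  have h1 := h (Sum.elim (t⁻¹ • (D *ᵥ v)) v) (fun h0 => hv (by
    ext a
    exact congrFun h0 (Sum.inr a)))
  rw [dilation_mulVec, sumElim_dotProduct_sumElim, sumElim_dotProduct_sumElim, mulVec_smul,
    dotProduct_smul, smul_dotProduct, smul_dotProduct, dotProduct_smul, smul_eq_mul, smul_eq_mul,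
    smul_eq_mul, mulVec_transpose, dotProduct_comm v, ← dotProduct_mulVec] at h1
  set w := (D *ᵥ v) ⬝ᵥ (D *ᵥ v)
  have h2 : t * (t⁻¹ * (t⁻¹ * w) + v ⬝ᵥ v) = t⁻¹ * w + t * (v ⬝ᵥ v) := by
    field_simp
  rw [h2] at h1
  have h3 : t⁻¹ * w < t * (v ⬝ᵥ v) := by linarith
  rw [inv_mul_lt_iff₀ ht] at h3
  linarith

/-- The contribution of one trajectory to a multiple of the empirical value matrix. -/
noncomputable def sampleMatrix (c γ : ℝ) (τ : ℕ) (ω : ℕ → Transition S A) :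
    Matrix (Fin S) (Fin A) ℝ :=
  Matrix.single (ω 0).1 (ω 0).2.1 (c * truncatedReturn γ τ ω)

theorem measurable_sampleMatrix_apply (c γ : ℝ) (τ : ℕ) (s : Fin S) (a : Fin A) :
    Measurable fun ω : ℕ → Transition S A => sampleMatrix c γ τ ω s a := by
  simp only [sampleMatrix, Matrix.single_apply]
  refine Measurable.ite ?_ ((measurable_truncatedReturn γ τ).const_mul c) measurable_const
  exact (measurableSet_eq_fun (measurable_fst.comp (measurable_pi_apply 0)) measurable_const).inter
    (measurableSet_eq_fun (measurable_fst.comp (measurable_snd.comp (measurable_pi_apply 0)))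
      measurable_const)

/-- With a single entry, the squared dilation is diagonal and supported on the starting state and
action. Averaging over a uniform start therefore gives a second moment far below the almost sure
bound. -/
theorem dilation_sampleMatrix_dotProduct_self (c γ : ℝ) (τ : ℕ) (ω : ℕ → Transition S A)
    (x : Fin S → ℝ) (y : Fin A → ℝ) :
    (dilation (sampleMatrix c γ τ ω) *ᵥ Sum.elim x y) ⬝ᵥ
      (dilation (sampleMatrix c γ τ ω) *ᵥ Sum.elim x y)
      = (c * truncatedReturn γ τ ω) ^ 2 * (y (ω 0).2.1 ^ 2 + x (ω 0).1 ^ 2) := by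
  rw [dilation_mulVec, sumElim_dotProduct_sumElim, sampleMatrix, Matrix.transpose_single,
    Matrix.single_mulVec, Matrix.single_mulVec]
  simp [dotProduct, Function.update_apply]
  ring

variable (M : MDP S A) (π : Policy S A) {rmax γ : ℝ}

theorem MDP.integrable_truncatedReturn (hM : M.RewardBoundedBy rmax) (h0 : 0 ≤ γ) (h1 : γ < 1)
    (τ : ℕ) (s : Fin S) (a : Fin A) :
    Integrable (truncatedReturn (S := S) (A := A) γ τ) (M.trajLaw π s a) := by
  refine Integrable.of_bound (measurable_truncatedReturn γ τ).aestronglyMeasurable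
    (rmax / (1 - γ)) ?_
  filter_upwards [M.ae_trajLaw_reward π hM s a] with ω hω using abs_truncatedReturn_le h0 h1 τ hω

/-- Only the trajectories that start at (s, a) contribute, and they carry weight 1 / (SA) in the
mixture. -/
theorem MDP.integral_sampleMatrix_apply (hM : M.RewardBoundedBy rmax) (h0 : 0 ≤ γ) (h1 : γ < 1)
    (c : ℝ) (τ : ℕ) (s : Fin S) (a : Fin A) :
    ∫ ω, sampleMatrix c γ τ ω s a ∂(M.unifLaw π)
      = ((S : ℝ) * A)⁻¹ * c * M.truncatedQ π γ τ s a := by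
  have hae : ∀ s' a', (fun ω => sampleMatrix c γ τ ω s a) =ᵐ[M.trajLaw π s' a']
      fun ω => if s' = s ∧ a' = a then c * truncatedReturn γ τ ω else 0 := fun s' a' => by
    filter_upwards [M.ae_trajLaw_start π s' a'] with ω hω
    rw [sampleMatrix, Matrix.single_apply, hω.1, hω.2]
  rw [M.integral_unifLaw π]
  · simp only [integral_congr_ae (hae _ _)]
    rw [Finset.sum_eq_single s, Finset.sum_eq_single a]
    · simp only [and_self, if_true, integral_const_mul, MDP.truncatedQ, Matrix.of_apply]
      ring
    · intro a' _ h
      simp [h]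
    · simp
    · intro s' _ h
      simp [h]
    · simp
  · intro s' a'
    refine Integrable.congr ?_ (hae s' a').symm
    split_ifs
    · exact (M.integrable_truncatedReturn π hM h0 h1 τ s' a').const_mul c
    · exact integrable_const _

theorem MDP.matrixMean_dilation_sampleMatrix (hM : M.RewardBoundedBy rmax) (h0 : 0 ≤ γ)
    (h1 : γ < 1) (c : ℝ) (τ : ℕ) :
    matrixMean (M.unifLaw π) (fun ω => dilation (sampleMatrix c γ τ ω))
      = dilation ((((S : ℝ) * A)⁻¹ * c) • M.truncatedQ π γ τ) := by
  ext i j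
  rcases i with i | i <;> rcases j with j | j <;>
    simp [matrixMean, dilation, M.integral_sampleMatrix_apply π hM h0 h1]

theorem sq_le_dotProduct_self {n : Type*} [Fintype n] (x : n → ℝ) (i : n) : x i ^ 2 ≤ x ⬝ᵥ x := by
  rw [pow_two]
  exact Finset.single_le_sum (f := fun i => x i * x i) (fun i _ => mul_self_nonneg _)
    (Finset.mem_univ i)

/-- Deviation of the empirical value matrix from its expectation. -/
theorem MDP.dataLaw_deviation_le (hM : M.RewardBoundedBy rmax) (h0 : 0 ≤ γ) (h1 : γ < 1)
    (hS : 0 < S) (hA : 0 < A) (c : ℝ) (τ N : ℕ) (t : ℝ)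
    (hc : 2 * ((c * (rmax / (1 - γ))) ^ 2 +
      (c * (rmax / (1 - γ))) ^ 2 * ((S + A) / (S * A))) ≤ 1) :
    M.dataLaw π N {ω | ∃ u, u ≠ 0 ∧ t * (u ⬝ᵥ u) ≤ u ⬝ᵥ
        (dilation (∑ k, (sampleMatrix c γ τ (ω k) -
          (((S : ℝ) * A)⁻¹ * c) • M.truncatedQ π γ τ)) *ᵥ u)}
      ≤ ENNReal.ofReal ((S + A) *
        Real.exp (N * ((c * (rmax / (1 - γ))) ^ 2 * ((S + A) / (S * A))) - t)) := by
  have hp := M.isProbabilityMeasure_unifLaw π hS hA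
  set b := (c * (rmax / (1 - γ))) ^ 2 with hb
  have hS' : (0 : ℝ) < S := by exact_mod_cast hS
  have hA' : (0 : ℝ) < A := by exact_mod_cast hA
  have hG : ∀ {ω : ℕ → Transition S A}, (∀ t, |(ω t).2.2| ≤ rmax) →
      (c * truncatedReturn γ τ ω) ^ 2 ≤ b := fun {ω} hω => by
    have h2 := abs_le.1 (abs_truncatedReturn_le h0 h1 τ hω)
    rw [hb, mul_pow, mul_pow]
    exact mul_le_mul_of_nonneg_left (sq_le_sq' h2.1 h2.2) (sq_nonneg c)
  have hY : ∀ i j, Measurable fun ω : ℕ → Transition S A =>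
      dilation (sampleMatrix c γ τ ω) i j := by
    rintro (i | i) (j | j) <;> simp only [dilation, Matrix.fromBlocks_apply₁₁,
      Matrix.fromBlocks_apply₁₂, Matrix.fromBlocks_apply₂₁, Matrix.fromBlocks_apply₂₂,
      Matrix.transpose_apply]
    · exact measurable_const
    · exact measurable_sampleMatrix_apply c γ τ i j
    · exact measurable_sampleMatrix_apply c γ τ j i
    · exact measurable_const
  have hsplit : ∀ u : Fin S ⊕ Fin A → ℝ, u = Sum.elim (u ∘ Sum.inl) (u ∘ Sum.inr) := fun u =>
    (Sum.elim_comp_inl_inr u).symm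
  have ha : ∀ᵐ ω ∂(M.unifLaw π), ∀ u, (dilation (sampleMatrix c γ τ ω) *ᵥ u) ⬝ᵥ
      (dilation (sampleMatrix c γ τ ω) *ᵥ u) ≤ b * (u ⬝ᵥ u) := by
    refine M.unifLaw_ae π fun s a => ?_
    filter_upwards [M.ae_trajLaw_reward π hM s a] with ω hω u
    rw [hsplit u, dilation_sampleMatrix_dotProduct_self, sumElim_dotProduct_sumElim]
    have e1 := sq_le_dotProduct_self (u ∘ Sum.inl) (ω 0).1
    have e2 := sq_le_dotProduct_self (u ∘ Sum.inr) (ω 0).2.1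
    exact mul_le_mul (hG hω) (by linarith) (by positivity) (sq_nonneg _)
  -- The uniform average is b (S‖y‖² + A‖x‖²) / (SA); both S and A are then relaxed to S + A.
  have hv : ∀ u, ∫ ω, (dilation (sampleMatrix c γ τ ω) *ᵥ u) ⬝ᵥ
      (dilation (sampleMatrix c γ τ ω) *ᵥ u) ∂(M.unifLaw π)
      ≤ b * ((S + A) / (S * A)) * (u ⬝ᵥ u) := by
    intro u
    rw [hsplit u]
    set x := u ∘ Sum.inl
    set y := u ∘ Sum.inr
    simp only [dilation_sampleMatrix_dotProduct_self, sumElim_dotProduct_sumElim]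
    have hbd : ∀ s a, ∀ᵐ ω ∂(M.trajLaw π s a),
        (c * truncatedReturn γ τ ω) ^ 2 * (y (ω 0).2.1 ^ 2 + x (ω 0).1 ^ 2)
          ≤ b * (y a ^ 2 + x s ^ 2) := fun s a => by
      filter_upwards [M.ae_trajLaw_reward π hM s a, M.ae_trajLaw_start π s a] with ω hω hω'
      rw [hω'.1, hω'.2]
      exact mul_le_mul_of_nonneg_right (hG hω) (by positivity)
    have hm : Measurable fun ω : ℕ → Transition S A =>
        (c * truncatedReturn γ τ ω) ^ 2 * (y (ω 0).2.1 ^ 2 + x (ω 0).1 ^ 2) := by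
      refine (((measurable_truncatedReturn γ τ).const_mul c).pow_const 2).mul
        (Measurable.add (Measurable.pow_const ?_ 2) (Measurable.pow_const ?_ 2))
      · exact (measurable_of_countable y).comp (by fun_prop)
      · exact (measurable_of_countable x).comp (by fun_prop)
    have hint : ∀ s a, Integrable (fun ω : ℕ → Transition S A =>
        (c * truncatedReturn γ τ ω) ^ 2 * (y (ω 0).2.1 ^ 2 + x (ω 0).1 ^ 2))
        (M.trajLaw π s a) := fun s a => by
      refine Integrable.of_bound hm.aestronglyMeasurable (b * (y a ^ 2 + x s ^ 2)) ?_
      filter_upwards [hbd s a] with ω hω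
      rwa [Real.norm_of_nonneg (by positivity)]
    rw [M.integral_unifLaw π hint]
    have hle : ∀ s a, ∫ ω, (c * truncatedReturn γ τ ω) ^ 2 * (y (ω 0).2.1 ^ 2 + x (ω 0).1 ^ 2)
        ∂(M.trajLaw π s a) ≤ b * (y a ^ 2 + x s ^ 2) := fun s a => by
      simpa using integral_mono_ae (hint s a) (integrable_const _) (hbd s a)
    have hx : x ⬝ᵥ x = ∑ s, x s ^ 2 := by simp [dotProduct, pow_two]
    have hy : y ⬝ᵥ y = ∑ a, y a ^ 2 := by simp [dotProduct, pow_two]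
    calc _ ≤ ((S : ℝ) * A)⁻¹ * ∑ s : Fin S, ∑ a : Fin A, b * (y a ^ 2 + x s ^ 2) := by
          gcongr with s _ a _
          exact hle s a
      _ = ((S : ℝ) * A)⁻¹ * (b * (S * (y ⬝ᵥ y) + A * (x ⬝ᵥ x))) := by
          simp only [← Finset.mul_sum, Finset.sum_add_distrib, hx, hy, Finset.sum_const,
            Finset.card_univ, Fintype.card_fin, nsmul_eq_mul]
      _ ≤ ((S : ℝ) * A)⁻¹ * (b * ((S + A) * (x ⬝ᵥ x + y ⬝ᵥ y))) := by
          have hx0 : 0 ≤ x ⬝ᵥ x := Finset.sum_nonneg fun i _ => mul_self_nonneg _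
          have hy0 : 0 ≤ y ⬝ᵥ y := Finset.sum_nonneg fun i _ => mul_self_nonneg _
          gcongr
          nlinarith [mul_nonneg hS'.le hx0, mul_nonneg hA'.le hy0]
      _ = _ := by ring
  have key := measure_exists_le_dotProduct_sum_le hY (fun ω => dilation_isSymm _) ha hv
    (by positivity) hc N t
  rw [M.matrixMean_dilation_sampleMatrix π hM h0 h1] at key
  simp only [Fintype.card_sum, Fintype.card_fin, Nat.cast_add] at key
  refine le_trans (le_of_eq ?_) key
  rw [MDP.dataLaw]
  congr 1
  ext ω
  have : dilation (∑ k, (sampleMatrix c γ τ (ω k) -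
      (((S : ℝ) * A)⁻¹ * c) • M.truncatedQ π γ τ)) = ∑ k, (dilation (sampleMatrix c γ τ (ω k)) -
        dilation ((((S : ℝ) * A)⁻¹ * c) • M.truncatedQ π γ τ)) := by
    ext i j
    rcases i with i | i <;> rcases j with j | j <;>
      simp [dilation, Matrix.sum_apply]
  simp only [Set.mem_ofPred_eq, this]

theorem sum_sampleMatrix_eq (γ θ : ℝ) (τ : ℕ) {N : ℕ} (ω : Fin N → ℕ → Transition S A) :
    ∑ k, sampleMatrix (θ * (S * A / N)) γ τ (ω k) = θ • empiricalQ γ τ ω := by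
  ext s a
  simp only [Matrix.sum_apply, sampleMatrix, Matrix.single_apply, Matrix.smul_apply, empiricalQ,
    Matrix.of_apply, smul_eq_mul, Finset.mul_sum, truncatedReturn, mul_ite, mul_zero]
  refine Finset.sum_congr rfl fun k _ => ?_
  split_ifs
  · exact Finset.sum_congr rfl fun t _ => by ring
  · rfl

end Concentration

/-! ### Operator norm bounds, horizon and number of trajectories -/

section Thresholding

open Matrix Module

variable {S A : ℕ}

theorem norm_toEuclideanLin_sq (D : Matrix (Fin S) (Fin A) ℝ) (v : EuclideanSpace ℝ (Fin A)) :
    ‖Matrix.toEuclideanLin D v‖ ^ 2 = (D *ᵥ v.ofLp) ⬝ᵥ (D *ᵥ v.ofLp) := by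
  rw [EuclideanSpace.real_norm_sq_eq]
  simp [dotProduct, pow_two]

theorem norm_sq_eq_dotProduct {n : Type*} [Fintype n] (v : EuclideanSpace ℝ n) :
    ‖v‖ ^ 2 = v.ofLp ⬝ᵥ v.ofLp := by
  rw [EuclideanSpace.real_norm_sq_eq]
  simp [dotProduct, pow_two]

theorem norm_toEuclideanLin_le {D : Matrix (Fin S) (Fin A) ℝ} {ε : ℝ} (hε : 0 ≤ ε)
    (h : ∀ s a, |D s a| ≤ ε) (v : EuclideanSpace ℝ (Fin A)) :
    ‖Matrix.toEuclideanLin D v‖ ≤ ε * √(S * A) * ‖v‖ := by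
  rw [← sq_le_sq₀ (norm_nonneg _) (by positivity), mul_pow, mul_pow, Real.sq_sqrt (by positivity),
    EuclideanSpace.real_norm_sq_eq]
  have hs : ∀ s, (Matrix.toEuclideanLin D v) s ^ 2 ≤ ε ^ 2 * A * ‖v‖ ^ 2 := fun s => by
    have h1 : (Matrix.toEuclideanLin D v) s = ∑ a, D s a * v a := rfl
    rw [h1]
    refine (Finset.sum_mul_sq_le_sq_mul_sq _ _ _).trans ?_
    rw [EuclideanSpace.real_norm_sq_eq]
    gcongr
    calc ∑ a, D s a ^ 2 ≤ ∑ _a : Fin A, ε ^ 2 :=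
          Finset.sum_le_sum fun a _ => sq_le_sq' (abs_le.1 (h s a)).1 (abs_le.1 (h s a)).2
      _ = ε ^ 2 * A := by simp [mul_comm]
  refine (Finset.sum_le_sum fun s _ => hs s).trans_eq ?_
  simp
  ring

/-- The upper bound comes from a unit right singular vector and the Frobenius norm. It makes the
sample size condition imply a lower bound on T free of σ. -/
theorem singularValue_rank_le {Q : Matrix (Fin S) (Fin A) ℝ} (hQ : Q ≠ 0) {ε : ℝ} (hε : 0 ≤ ε)
    (h : ∀ s a, |Q s a| ≤ ε) :
    0 < singularValue Q Q.rank ∧ singularValue Q Q.rank ≤ ε * √(S * A) := by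
  have hr := rank_eq_finrank_range_toEuclideanLin Q
  have h0 := rank_pos_of_ne_zero hQ
  have hpos : 0 < singularValue Q Q.rank := by
    rw [singularValue, LinearMap.singularValues_pos_iff_lt_finrank_range, ← hr]
    omega
  refine ⟨hpos, ?_⟩
  obtain ⟨b, hb⟩ := exists_orthonormalBasis_norm_sq_apply (Matrix.toEuclideanLin Q)
  have hlt : Q.rank - 1 < finrank ℝ (EuclideanSpace ℝ (Fin A)) := by
    have := (Matrix.toEuclideanLin Q).finrank_range_le
    omega
  have h1 := hb (b ⟨_, hlt⟩)
  rw [Finset.sum_eq_single ⟨_, hlt⟩ (fun j _ hj => by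
    rw [b.inner_eq_zero hj]; simp) (by simp), real_inner_self_eq_norm_sq, b.norm_eq_one] at h1
  have h2 := norm_toEuclideanLin_le hε h (b ⟨_, hlt⟩)
  rw [b.norm_eq_one, mul_one] at h2
  rw [← sq_le_sq₀ hpos.le (by positivity)]
  calc singularValue Q Q.rank ^ 2 = ‖Matrix.toEuclideanLin Q (b ⟨_, hlt⟩)‖ ^ 2 := by
        rw [h1, singularValue]; simp
    _ ≤ _ := by gcongr

/-- The truncation bias is at most `rmax / T` in every entry. -/
theorem pow_horizon_mul_le {rmax γ : ℝ} {T : ℕ} (hr : 0 ≤ rmax) (h0 : 0 ≤ γ) (h1 : γ < 1)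
    (hT : 1 ≤ T) : γ ^ (horizon γ T + 1) * (rmax / (1 - γ)) ≤ rmax / T := by
  have hp : 0 < 1 - γ := by linarith
  have hT' : (0 : ℝ) < T := by exact_mod_cast hT
  have h2 : γ ^ (horizon γ T + 1) ≤ (1 - γ) / T := by
    calc γ ^ (horizon γ T + 1) ≤ γ ^ horizon γ T :=
          pow_le_pow_of_le_one h0 h1.le (Nat.le_succ _)
      -- Here γ = 1 - (1 - γ) ≤ e^{-(1 - γ)}; the horizon is chosen so that this power is at most (1
      -- - γ) / T.
      _ ≤ Real.exp (-(1 - γ)) ^ horizon γ T := by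
          gcongr
          linarith [Real.add_one_le_exp (-(1 - γ))]
      _ = Real.exp (-((1 - γ) * horizon γ T)) := by
          rw [← Real.exp_nat_mul]
          congr 1
          ring
      _ ≤ Real.exp (-Real.log (T / (1 - γ))) := by
          gcongr
          have := Nat.le_ceil (1 / (1 - γ) * Real.log (T / (1 - γ)))
          calc Real.log (T / (1 - γ))
              = (1 - γ) * (1 / (1 - γ) * Real.log (T / (1 - γ))) := by field_simp
            _ ≤ (1 - γ) * horizon γ T := by
                gcongr
                exact this
      _ = (1 - γ) / T := by
          rw [Real.exp_neg, Real.exp_log (by positivity), inv_div]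
  calc γ ^ (horizon γ T + 1) * (rmax / (1 - γ)) ≤ (1 - γ) / T * (rmax / (1 - γ)) := by
        gcongr
    _ = rmax / T := by field_simp

/-- One trajectory costs at most 3l / (1 - γ) steps. The rounding in N loses at most one trajectory,
which `hTl` absorbs by doubling 3 to 6. -/
theorem le_numTraj {γ l : ℝ} {T : ℕ} (h0 : 0 ≤ γ) (h1 : γ < 1) (hT : 1 ≤ T)
    (hl : 1 ≤ l) (hlog : Real.log (T / (1 - γ)) ≤ l) (hTl : 6 * l ≤ T * (1 - γ)) :
    T * (1 - γ) ≤ 6 * l * numTraj γ T := by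
  have hp : 0 < 1 - γ := by linarith
  have hp1 : 1 - γ ≤ 1 := by linarith
  have hT' : (1 : ℝ) ≤ T := by exact_mod_cast hT
  have hlog0 : 0 ≤ Real.log (T / (1 - γ)) :=
    Real.log_nonneg (by rw [le_div_iff₀ hp]; linarith)
  have h2 : (horizon γ T : ℝ) < 1 / (1 - γ) * Real.log (T / (1 - γ)) + 1 :=
    Nat.ceil_lt_add_one (by positivity)
  have h3 : (horizon γ T + 1 : ℝ) * (1 - γ) ≤ 3 * l := by
    calc (horizon γ T + 1 : ℝ) * (1 - γ)
        ≤ (1 / (1 - γ) * Real.log (T / (1 - γ)) + 2) * (1 - γ) :=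
          mul_le_mul_of_nonneg_right (by linarith) hp.le
      _ = Real.log (T / (1 - γ)) + 2 * (1 - γ) := by field_simp
      _ ≤ 3 * l := by linarith
  have h4 : (T : ℝ) < (numTraj γ T + 1) * (horizon γ T + 1) := by
    have := Nat.lt_div_mul_add (a := T) (b := horizon γ T + 1) (Nat.succ_pos _)
    have h : T < (numTraj γ T + 1) * (horizon γ T + 1) := by
      rw [numTraj]
      linarith
    exact_mod_cast h
  have h5 : T * (1 - γ) ≤ (numTraj γ T + 1) * (3 * l) := by
    calc T * (1 - γ) ≤ (numTraj γ T + 1) * (horizon γ T + 1) * (1 - γ) := by gcongr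
      _ = (numTraj γ T + 1) * ((horizon γ T + 1) * (1 - γ)) := by ring
      _ ≤ _ := by gcongr
  linarith

end Thresholding

/-! ### Choice of parameters and numerical constants -/

section SampleComplexity

open Matrix

/-- With x = S, y = A, p = 1 - γ, r = rmax and scaling 2l / R, the Bernstein variance is v = 4Tp /
(l²N²) ≤ 24 / (lN), and the almost sure bound is a = v xy / (x + y) ≤ 24 / l. Taking l ≥ 100 makes
2(a + v) ≤ 1 and N v ≤ l. -/
theorem bernstein_parameters_le {x y p T r l N R : ℝ} (hx : 1 ≤ x) (hy : 1 ≤ y) (hp : 0 < p)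
    (hT : 0 < T) (hr : 0 < r) (hl : 100 ≤ l) (hTl : (x + y) * l ^ 4 ≤ T * p)
    (hN : T * p ≤ 6 * l * N) (hR : R ^ 2 = r ^ 2 * x * y * (x + y) / (p ^ 3 * T) * l ^ 4) :
    2 * ((2 * l / R * (x * y / N) * (r / p)) ^ 2 +
      (2 * l / R * (x * y / N) * (r / p)) ^ 2 * ((x + y) / (x * y))) ≤ 1 ∧
    N * ((2 * l / R * (x * y / N) * (r / p)) ^ 2 * ((x + y) / (x * y))) ≤ l := by
  have hl0 : 0 < l := by linarith
  have hn : 2 ≤ x + y := by linarith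
  have hN3 : (x + y) * l ^ 3 ≤ 6 * N := by
    have : l * ((x + y) * l ^ 3) ≤ l * (6 * N) := by nlinarith
    exact le_of_mul_le_mul_left this hl0
  have hl3 : 100 ^ 3 ≤ l ^ 3 := by gcongr
  have hN1 : (x + y) * 1 ≤ N := by nlinarith
  have hN0 : 0 < N := by linarith
  have e : (2 * l / R * (x * y / N) * (r / p)) ^ 2
      = 4 * (x * y) * (T * p) / ((x + y) * l ^ 2 * N ^ 2) := by
    rw [mul_pow, mul_pow, div_pow, hR]
    field_simp
    ring
  have e2 : 4 * (x * y) * (T * p) / ((x + y) * l ^ 2 * N ^ 2) * ((x + y) / (x * y))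
      = 4 * (T * p) / (l ^ 2 * N ^ 2) := by
    field_simp
  have b2 : 4 * (T * p) / (l ^ 2 * N ^ 2) ≤ 24 / (l * N) := by
    rw [div_le_div_iff₀ (by positivity) (by positivity)]
    have := mul_le_mul_of_nonneg_right hN (show 0 ≤ 4 * (l * N) by positivity)
    nlinarith
  have b1 : 4 * (x * y) * (T * p) / ((x + y) * l ^ 2 * N ^ 2) ≤ 24 / l := by
    have e3 : 4 * (x * y) * (T * p) / ((x + y) * l ^ 2 * N ^ 2)
        = (x * y / (x + y)) * (4 * (T * p) / (l ^ 2 * N ^ 2)) := by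
      field_simp
    have h1 : x * y / (x + y) ≤ N := by
      rw [div_le_iff₀ (by positivity)]
      nlinarith
    rw [e3]
    calc _ ≤ N * (24 / (l * N)) := by gcongr
      _ = 24 / l := by field_simp
  have b3 : 24 / (l * N) ≤ 24 / l := by
    gcongr
    nlinarith
  have b4 : 24 / l ≤ 24 / 100 := by gcongr
  rw [e, e2]
  constructor
  · linarith
  · calc N * (4 * (T * p) / (l ^ 2 * N ^ 2)) ≤ N * (24 / (l * N)) := by gcongr
      _ = 24 / l := by field_simp
      _ ≤ l := by linarith

/-- The truncation term is dominated by the statistical term, as its square decays like 1 / T² and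
the other factors are at least 1. -/
theorem threshold_le_two_mul_sqrt {S A T : ℕ} {rmax γ δ : ℝ} (hS : 1 ≤ S) (hA : 1 ≤ A) (hT : 1 ≤ T)
    (h0 : 0 ≤ γ) (h1 : γ < 1) (hl : 1 ≤ logFactor S A γ δ T) :
    threshold S A rmax γ δ T
      ≤ 2 * √(rmax ^ 2 * S * A * (S + A) / ((1 - γ) ^ 3 * T) * logFactor S A γ δ T ^ 4) := by
  have hp : 0 < 1 - γ := by linarith
  have hS' : (1 : ℝ) ≤ S := by exact_mod_cast hS
  have hA' : (1 : ℝ) ≤ A := by exact_mod_cast hA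
  have hT' : (1 : ℝ) ≤ T := by exact_mod_cast hT
  rw [threshold, two_mul]
  gcongr
  apply Real.le_sqrt_of_sq_le
  rw [div_pow, mul_pow, Real.sq_sqrt (by positivity)]
  have h2 : (1 - γ) ^ 3 ≤ 1 := pow_le_one₀ hp.le (by linarith)
  have h3 : 1 ≤ logFactor S A γ δ T ^ 4 := one_le_pow₀ hl
  calc rmax ^ 2 * (S * A) / T ^ 2 = rmax ^ 2 * S * A * 1 / (T * T) * 1 := by ring
    _ ≤ rmax ^ 2 * S * A * (S + A) / ((1 - γ) ^ 3 * T) * logFactor S A γ δ T ^ 4 := by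
      gcongr
      · linarith
      · linarith

variable {S A : ℕ} (M : MDP S A) (π : Policy S A) {rmax γ δ : ℝ}

/-- The factor 2 is crude: one rmax / (1 - γ) for the first reward, one for the truncation bias at τ
= 0. -/
theorem MDP.abs_Q_le (hM : M.RewardBoundedBy rmax) (h0 : 0 ≤ γ) (h1 : γ < 1) (hr : 0 ≤ rmax)
    (s : Fin S) (a : Fin A) : |M.Q π γ s a| ≤ 2 * (rmax / (1 - γ)) := by
  have hp : 0 < 1 - γ := by linarith
  have h2 := M.abs_Q_sub_truncatedQ_le π hM h0 h1 0 s a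
  have h3 : |M.truncatedQ π γ 0 s a| ≤ rmax / (1 - γ) := by
    have hb : ∀ᵐ ω ∂(M.trajLaw π s a), ‖truncatedReturn γ 0 ω‖ ≤ rmax / (1 - γ) := by
      filter_upwards [M.ae_trajLaw_reward π hM s a] with ω hω using
        abs_truncatedReturn_le h0 h1 0 hω
    simpa [MDP.truncatedQ] using norm_integral_le_of_norm_le_const hb
  have h4 : γ ^ (0 + 1) * (rmax / (1 - γ)) ≤ 1 * (rmax / (1 - γ)) := by
    gcongr
    exact pow_le_one₀ h0 h1.le
  have h5 := abs_sub_abs_le_abs_sub (M.Q π γ s a) (M.truncatedQ π γ 0 s a)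
  linarith

theorem MDP.rmax_nonneg (hM : M.RewardBoundedBy rmax) (s : Fin S) (a : Fin A) : 0 ≤ rmax := by
  obtain ⟨x, hx⟩ := (hM s a).exists
  exact (abs_nonneg x).trans hx

/-- On the complement of the deviation event, thresholding recovers the rank. -/
theorem MDP.thresholdRank_empiricalQ_eq (hM : M.RewardBoundedBy rmax) (h0 : 0 ≤ γ) (h1 : γ < 1)
    {T N : ℕ} (hT : 1 ≤ T) (hr : 0 ≤ rmax) (hQ : M.Q π γ ≠ 0) (hN : 0 < N)
    (hS : 0 < S) (hA : 0 < A) {θ R : ℝ} (hθ : 0 < θ) (hR : 0 < R)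
    (hσ : 2 * (R + rmax * √((S : ℝ) * A) / T) ≤ singularValue (M.Q π γ) (M.Q π γ).rank)
    {ω : Fin N → ℕ → Transition S A}
    (hω : ∀ u, u ≠ 0 → u ⬝ᵥ (dilation (∑ k, (sampleMatrix (θ * (S * A / N)) γ (horizon γ T) (ω k) -
          (((S : ℝ) * A)⁻¹ * (θ * (S * A / N))) • M.truncatedQ π γ (horizon γ T))) *ᵥ u)
        < θ * R * (u ⬝ᵥ u)) :
    thresholdRank (empiricalQ γ (horizon γ T) ω) (R + rmax * √((S : ℝ) * A) / T)
      = (M.Q π γ).rank := by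
  have hS' : (0 : ℝ) < S := by exact_mod_cast hS
  have hA' : (0 : ℝ) < A := by exact_mod_cast hA
  have hN' : (0 : ℝ) < N := by exact_mod_cast hN
  set B := empiricalQ γ (horizon γ T) ω
  set Q' := M.truncatedQ π γ (horizon γ T)
  have hD : ∑ k, (sampleMatrix (θ * (S * A / N)) γ (horizon γ T) (ω k) -
      (((S : ℝ) * A)⁻¹ * (θ * (S * A / N))) • Q') = θ • (B - Q') := by
    rw [Finset.sum_sub_distrib, sum_sampleMatrix_eq, smul_sub, Finset.sum_const, Finset.card_univ,
      Fintype.card_fin, ← Nat.cast_smul_eq_nsmul ℝ, smul_smul]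
    congr 2
    field_simp
  rw [hD] at hω
  refine thresholdRank_eq_rank _ _ hQ (by positivity) (fun v hv => ?_) hσ
  have hv' : v.ofLp ≠ 0 := fun h => hv (by ext i; exact congrFun h i)
  have h2 := mulVec_dotProduct_self_lt_of_dilation (by positivity) hω hv'
  -- The scaling θ cancels, leaving sampling error below R; the bias adds the second summand of the
  -- threshold.
  have h3 : ‖Matrix.toEuclideanLin (B - Q') v‖ < R * ‖v‖ := by
    rw [← sq_lt_sq₀ (norm_nonneg _) (by positivity), mul_pow, norm_toEuclideanLin_sq,
      norm_sq_eq_dotProduct]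
    rw [smul_mulVec, smul_dotProduct, dotProduct_smul, smul_eq_mul, smul_eq_mul] at h2
    refine lt_of_mul_lt_mul_left (a := θ ^ 2) ?_ (sq_nonneg θ)
    linarith
  have h4 : ‖Matrix.toEuclideanLin (Q' - M.Q π γ) v‖ ≤ rmax / T * √(S * A) * ‖v‖ := by
    refine norm_toEuclideanLin_le (by positivity) (fun s a => ?_) v
    rw [Matrix.sub_apply, abs_sub_comm]
    exact (M.abs_Q_sub_truncatedQ_le π hM h0 h1 _ s a).trans (pow_horizon_mul_le hr h0 h1 hT)
  have h5 : Matrix.toEuclideanLin (B - M.Q π γ) v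
      = Matrix.toEuclideanLin (B - Q') v + Matrix.toEuclideanLin (Q' - M.Q π γ) v := by
    rw [← LinearMap.add_apply, ← map_add, sub_add_sub_cancel]
  rw [h5]
  refine (norm_add_le _ _).trans_lt ?_
  calc _ < R * ‖v‖ + rmax / T * √(S * A) * ‖v‖ := by linarith
    _ = _ := by ring

/-- The sample size condition forces the sample size and the logarithmic factor to be large. -/
theorem MDP.sample_size_lower_bounds (hM : M.RewardBoundedBy rmax) (h0 : 0 ≤ γ) (h1 : γ < 1)
    (hδ0 : 0 < δ) (hδ1 : δ < 1) {T : ℕ} (hT : 1 ≤ T) (hQ : M.Q π γ ≠ 0) (hS : 1 ≤ S) (hA : 1 ≤ A)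
    (hr : 0 ≤ rmax)
    (hC : 32 * Real.exp 100 * (rmax ^ 2 * S * A * (S + A)
            / ((1 - γ) ^ 3 * singularValue (M.Q π γ) (M.Q π γ).rank ^ 2)
            * logFactor S A γ δ T ^ 4) ≤ T) :
    100 ≤ logFactor S A γ δ T ∧ (S + A) * logFactor S A γ δ T ^ 4 ≤ T * (1 - γ) ∧ 0 < rmax ∧
    4 * √(rmax ^ 2 * S * A * (S + A) / ((1 - γ) ^ 3 * T) * logFactor S A γ δ T ^ 4)
      ≤ singularValue (M.Q π γ) (M.Q π γ).rank ∧
    Real.log (T / (1 - γ)) ≤ logFactor S A γ δ T := by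
  have hp : 0 < 1 - γ := by linarith
  have hS' : (1 : ℝ) ≤ S := by exact_mod_cast hS
  have hA' : (1 : ℝ) ≤ A := by exact_mod_cast hA
  have hT' : (1 : ℝ) ≤ T := by exact_mod_cast hT
  obtain ⟨hσ0, hσ1⟩ := singularValue_rank_le hQ (by positivity) (M.abs_Q_le π hM h0 h1 hr)
  set σ := singularValue (M.Q π γ) (M.Q π γ).rank
  set l := logFactor S A γ δ T with hl
  have hr0 : 0 < rmax := by
    refine lt_of_le_of_ne hr fun h => ?_
    rw [← h] at hσ1
    simp at hσ1
    linarith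
  have hσ2 : σ ^ 2 ≤ 4 * rmax ^ 2 * (S * A) / (1 - γ) ^ 2 := by
    calc σ ^ 2 ≤ (2 * (rmax / (1 - γ)) * √(S * A)) ^ 2 := by gcongr
      _ = _ := by
        rw [mul_pow, mul_pow, div_pow, Real.sq_sqrt (by positivity)]
        ring
  have hE : 1 ≤ Real.exp 100 := Real.one_le_exp (by norm_num)
  have hbig : 8 * Real.exp 100 * ((S + A) * l ^ 4) ≤ T * (1 - γ) := by
    have h2 : (S + A) * l ^ 4 / (4 * (1 - γ)) ≤ rmax ^ 2 * S * A * (S + A)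
            / ((1 - γ) ^ 3 * σ ^ 2) * l ^ 4 := by
      calc (S + A) * l ^ 4 / (4 * (1 - γ)) = rmax ^ 2 * S * A * (S + A)
            / ((1 - γ) ^ 3 * (4 * rmax ^ 2 * (S * A) / (1 - γ) ^ 2)) * l ^ 4 := by
            field_simp
        _ ≤ _ := by gcongr
    have h3 := (mul_le_mul_of_nonneg_left h2
      (show 0 ≤ 32 * Real.exp 100 by positivity)).trans hC
    have h4 : 32 * Real.exp 100 * ((S + A) * l ^ 4 / (4 * (1 - γ)))
      = 8 * Real.exp 100 * ((S + A) * l ^ 4) / (1 - γ) := by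
      field_simp
      ring
    rwa [h4, div_le_iff₀ hp] at h3
  have hlog1 : Real.log (T / (1 - γ)) ≤ l := by
    rw [hl, logFactor]
    refine Real.log_le_log (by positivity) ?_
    rw [div_le_div_iff₀ hp (by positivity)]
    have : δ ≤ S + A := by linarith
    nlinarith [mul_le_mul_of_nonneg_left this (show 0 ≤ T * (1 - γ) by positivity)]
  have hlog2 : Real.log T ≤ l := by
    refine le_trans ?_ hlog1
    gcongr
    rw [le_div_iff₀ hp]
    nlinarith
  have hlog3 : Real.log 2 ≤ l := by
    rw [hl, logFactor]
    gcongr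
    rw [le_div_iff₀ (by positivity)]
    have h2 : (1 - γ) * δ ≤ 1 := mul_le_one₀ (by linarith) hδ0.le hδ1.le
    nlinarith
  -- Bootstrap: the crude l ≥ log 2 > 1/2 with S + A ≥ 2 already gives 8 e^100 (S + A) l⁴ ≥ e^100,
  -- so T ≥ e^100 and l ≥ log T ≥ 100.
  have hl4 : 1 / 16 ≤ l ^ 4 := by
    have h2 : (1 / 2 : ℝ) ≤ l := by linarith [Real.log_two_gt_d9]
    calc (1 / 16 : ℝ) = (1 / 2) ^ 4 := by norm_num
      _ ≤ l ^ 4 := by gcongr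
  have h100 : 100 ≤ l := by
    refine le_trans ?_ hlog2
    rw [Real.le_log_iff_exp_le (by linarith)]
    have h2 : 2 * (1 / 16) ≤ (S + A) * l ^ 4 := by
      gcongr
      linarith
    nlinarith
  refine ⟨h100, ?_, hr0, ?_, hlog1⟩
  · refine le_trans ?_ hbig
    have h2 : 0 ≤ ((S : ℝ) + A) * l ^ 4 := by positivity
    nlinarith
  -- After squaring, the required factor is 16, well below C.
  · rw [← sq_le_sq₀ (by positivity) hσ0.le, mul_pow, Real.sq_sqrt (by positivity)]
    have h2 : 4 ^ 2 * (rmax ^ 2 * S * A * (S + A) / ((1 - γ) ^ 3 * T) * l ^ 4) * (T / σ ^ 2)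
        ≤ T := by
      refine le_trans ?_ hC
      calc _ = 16 * (rmax ^ 2 * S * A * (S + A) / ((1 - γ) ^ 3 * σ ^ 2) * l ^ 4) := by
            field_simp
            ring
        _ ≤ _ := by
            gcongr
            linarith
    have h3 : (4 ^ 2 * (rmax ^ 2 * S * A * (S + A) / ((1 - γ) ^ 3 * T) * l ^ 4)) / σ ^ 2 * T
        ≤ 1 * T := by
      rw [one_mul]
      refine le_trans (le_of_eq ?_) h2
      ring
    have h4 := le_of_mul_le_mul_right h3 (by linarith)
    rwa [div_le_one (by positivity)] at h4

end SampleComplexity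

end LowRankRL

/-! ### Rank recovery with high probability -/

theorem mainTheorem6 :
    ∃ C : ℝ, 0 < C ∧
      ∀ (S A : ℕ) (M : LowRankRL.MDP S A) (π : LowRankRL.Policy S A) (rmax γ δ : ℝ) (T : ℕ),
        M.RewardBoundedBy rmax →
        0 ≤ γ → γ < 1 → 0 < δ → δ < 1 → 1 ≤ T →
        M.Q π γ ≠ 0 →
        C * (rmax ^ 2 * S * A * (S + A)
            / ((1 - γ) ^ 3 * LowRankRL.singularValue (M.Q π γ) (M.Q π γ).rank ^ 2)
            * LowRankRL.logFactor S A γ δ T ^ 4) ≤ T →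
        ENNReal.ofReal (1 - δ) ≤
          M.dataLaw π (LowRankRL.numTraj γ T)
            {ω | LowRankRL.thresholdRank
                (LowRankRL.empiricalQ γ (LowRankRL.horizon γ T) ω)
                (LowRankRL.threshold S A rmax γ δ T) = (M.Q π γ).rank} := by
  refine ⟨32 * Real.exp 100, by positivity, ?_⟩
  intro S A M π rmax γ δ T hM h0 h1 hδ0 hδ1 hT hQ hC
  obtain ⟨s, a, -⟩ : ∃ s a, M.Q π γ s a ≠ 0 := by
    by_contra! h
    exact hQ (by ext s a; exact h s a)
  have hS : 0 < S := s.pos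
  have hA : 0 < A := a.pos
  have hr := M.rmax_nonneg hM s a
  obtain ⟨hl, hTl, hr0, hσ, hlog⟩ :=
    M.sample_size_lower_bounds π hM h0 h1 hδ0 hδ1 hT hQ hS hA hr hC
  have hp : 0 < 1 - γ := by linarith
  have hS' : (1 : ℝ) ≤ S := by exact_mod_cast hS
  have hA' : (1 : ℝ) ≤ A := by exact_mod_cast hA
  have hT' : (1 : ℝ) ≤ T := by exact_mod_cast hT
  have hth := LowRankRL.threshold_le_two_mul_sqrt (rmax := rmax) (δ := δ) hS hA hT h0 h1 (by linarith)
  have hexp : Real.exp (LowRankRL.logFactor S A γ δ T)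
      = ((S : ℝ) + A) * T / ((1 - γ) * δ) := Real.exp_log (by positivity)
  set l := LowRankRL.logFactor S A γ δ T with hldef
  set N := LowRankRL.numTraj γ T
  set R := √(rmax ^ 2 * S * A * (S + A) / ((1 - γ) ^ 3 * T) * l ^ 4) with hRdef
  have hl0 : 0 < l := by linarith
  have hR : 0 < R := Real.sqrt_pos.2 (by positivity)
  have hR2 : R ^ 2 = rmax ^ 2 * S * A * (S + A) / ((1 - γ) ^ 3 * T) * l ^ 4 :=
    Real.sq_sqrt (by positivity)
  have hl6 : 6 * l ≤ T * (1 - γ) := by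
    refine le_trans ?_ hTl
    have h2 : 100 ^ 3 ≤ l ^ 3 := by gcongr
    calc 6 * l ≤ (1 + 1) * (100 ^ 3 * l) := by linarith
      _ ≤ (S + A) * (l ^ 3 * l) := by gcongr
      _ = _ := by ring
  have hN := LowRankRL.le_numTraj h0 h1 hT (by linarith) hlog hl6
  have hN0 : 0 < N := by
    by_contra! h
    have h2 : (N : ℝ) = 0 := by exact_mod_cast Nat.le_zero.1 h
    rw [show LowRankRL.numTraj γ T = N from rfl, h2] at hN
    linarith
  obtain ⟨hpar1, hpar2⟩ := LowRankRL.bernstein_parameters_le hS' hA' hp (by linarith) hr0 hl hTl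
    hN hR2
  -- The scale 2l / R plays the role of the Laplace parameter: deviation R becomes level 2l, against
  -- N v ≤ l.
  have hdev := M.dataLaw_deviation_le π hM h0 h1 hS hA (2 * l / R * (S * A / N))
    (LowRankRL.horizon γ T) N (2 * l / R * R) hpar1
  have := M.isProbabilityMeasure_unifLaw π hS hA
  have : IsProbabilityMeasure (M.dataLaw π N) := by
    unfold LowRankRL.MDP.dataLaw
    infer_instance
  have hbad : ((S : ℝ) + A) * Real.exp (N * ((2 * l / R * (S * A / N) * (rmax / (1 - γ))) ^ 2 *
      ((S + A) / (S * A))) - 2 * l / R * R) ≤ δ := by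
    calc _ ≤ ((S : ℝ) + A) * Real.exp (-l) := by
          gcongr
          rw [div_mul_cancel₀ _ hR.ne']
          linarith
      _ = (1 - γ) * δ / T := by
          rw [Real.exp_neg, hexp]
          field_simp
      _ ≤ δ := by
          rw [div_le_iff₀ (by linarith)]
          nlinarith [mul_le_mul_of_nonneg_left hT' hδ0.le, mul_nonneg h0 hδ0.le]
  have hdev' := hdev.trans (ENNReal.ofReal_le_ofReal hbad)
  -- Subadditivity in the form 1 ≤ μ(good) + μ(bad) avoids proving that the good event is
  -- measurable.
  rw [ENNReal.ofReal_sub _ hδ0.le, ENNReal.ofReal_one, tsub_le_iff_right]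
  refine le_trans ?_ (add_le_add_right hdev' _)
  rw [← measure_univ (μ := M.dataLaw π N)]
  refine (measure_mono fun ω _ => ?_).trans (measure_union_le _ _)
  by_contra hcon
  rw [Set.mem_union, not_or] at hcon
  obtain ⟨hc1, hc2⟩ := hcon
  refine hc1 (M.thresholdRank_empiricalQ_eq π hM h0 h1 hT hr hQ hN0 hS hA
    (θ := 2 * l / R) (R := R) (by positivity) hR ?_ ?_)
  -- β ≤ 2R and 4R ≤ σ_d together give 2β ≤ σ_d.
  · rw [LowRankRL.threshold] at hth
    linarith
  · intro u hu
    by_contra! h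
    exact hc2 ⟨u, hu, h⟩
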